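/- Let $(\mathcal P,d,\mu)$ be a metric measure space whose measure $\mu$ is Borel regular, non-atomic and doubling (there is $c$ with $\mu(2B)\le c\,\mu(B)$ for all balls $B$), and such that every ball has finite positive measure. All functions are extended real-valued and defined everywhere on $\mathcal P$; "measurable" means $\mu$-measurable, and $\fint_E$ denotes the integral mean over $E$. **Upper gradients, Poincaré inequality.** A Borel function $g:\mathcal P\to[0,\infty]$ is an *upper gradient* of $u:\mathcal P\to[-\infty,\infty]$ if $|u(\gamma(0))-u(\gamma(l_\gamma))|\le\int_\gamma g\,ds$ for every non-constant rectifiable curve $\gamma:[0,l_\gamma]\to\mathcal P$ parametrized by arc length (with $|(\pm\infty)-(\pm\infty)|=\infty$). For $p\in[1,\infty)$, $\mathcal P$ is a *$p$-Poincaré space* if there are $c>0$, $\lambda\ge1$ such that for all balls $B$, all $u$ integrable on balls and all upper gradients $g$ of $u$, $$\fint_B|u-u_B|\,d\mu\le c\,\mathrm{diam}(B)\Bigl(\fint_{\lambda B}g^p\,d\mu\Bigr)^{1/p},\qquad u_B=\fint_B u\,d\mu .$$ **R.i. spaces.** Let $X=\{u \text{ measurable}:\|u\|_X<\infty\}$ be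 a rearrangement-invariant Banach function space over $(\mathcal P,\mu)$: $\|\cdot\|_X$ is a norm (functions equal a.e. being identified); $|u|\le|v|$ a.e. implies $\|u\|_X\le\|v\|_X$; $0\le u_n\uparrow u$ a.e. implies $\|u_n\|_X\uparrow\|u\|_X$; for every measurable $E$ with $\mu(E)<\infty$, $\|\chi_E\|_X<\infty$ and $\int_E|u|\,d\mu\le C_E\|u\|_X$ for all measurable $u$; and $\|u\|_X=\|v\|_X$ if $\mu\{|u|>t\}=\mu\{|v|>t\}$ for all $t\ge0$. Its norm is *absolutely continuous* if $\|u\chi_{E_n}\|_X\to0$ for every $u\in X$ and every decreasing sequence of measurable sets $E_n$ with $\mu(\bigcap_nE_n)=0$. The *fundamental function* of $X$ is $\phi(t)=\|\chi_E\|_X$ with any measurable $E$ of measure $t$ if $0\le t<\mu(\mathcal P)$, and $\phi(t)=\|1\|_X$ if $t\ge\mu(\mathcal P)$. **Newtonian space.** $\|u\|_{N^1X}=\|u\|_X+\inf_g\|g\|_X$, the infimum being over all upper gradients $g$ of $u$, and $N^1X$ is the set of measurable $u$ with $\|u\|_{N^1X}<\infty$. **Notation.** Let $u^*(t)=\inf\{s\ge0:\mu\{|u|>s\}\le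 t\}$ (similarly for functions on $(0,\infty)$ with Lebesgue measure), and let $M_pf(t)=\sup_{B\ni t}(\fint_B|f|^p)^{1/p}$ be the non-centered maximal operator on $(0,\infty)$. Put $$\|u\|_{M^p_{\rm loc}(X)}=\sup_{0<t<1}M_pu^*(t)\,\phi(t),\qquad \|u\|_{\Lambda^p_\psi}=\Bigl(\int_0^\infty(u^*(t)\psi(t))^p\frac{dt}t\Bigr)^{1/p},\qquad \|u\|_{L^{p,1}}=\frac1p\int_0^\infty u^*(t)t^{1/p}\frac{dt}t,$$ where $\psi(0)=0$, $\psi(t)=t^{1/p}\sup_{t\le s\le1}\phi(s)s^{-1/p}$ for $0<t\le1$ and $\psi(t)=\phi(t)$ for $t\ge1$. Write $A\hookrightarrow B$ if $\|u\|_B\le c\|u\|_A$ for all $u\in A$ with some constant $c$, and $A\hookrightarrow B_{\rm fm}$ if for every measurable $E$ with $\mu(E)<\infty$ there is $c_E$ with $\|u\chi_E\|_B\le c_E\|u\|_A$ for all $u\in A$. Let $\overline X$ be the representation space of $X$, i.e. the r.i. space over $(0,\infty)$ with Lebesgue measure determined by $\|u\|_X=\|u^*\|_{\overline X}$ for all measurable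 $u$ on $\mathcal P$ and $\|f\|_{\overline X}=\|f^*\chi_{(0,\mu(\mathcal P))}\|_{\overline X}$, and let $E_{1/s}f(t)=f(t/s)$. The upper Boyd and the upper fundamental (Zippin) index of $X$ are $$\overline\alpha_X=\inf_{s>1}\frac{\log h_X(s)}{\log s},\quad \overline\beta_X=\inf_{s>1}\frac{\log k_X(s)}{\log s},\qquad h_X(s)=\sup_{0\ne f\in\overline X}\frac{\|E_{1/s}f\|_{\overline X}}{\|f\|_{\overline X}},\quad k_X(s)=\sup_{t>0}\frac{\phi(st)}{\phi(t)} .$$ **Theorem.** Assume that $\mathcal P$ is a $p$-Poincaré space for some $p\in[1,\infty)$ and that $X$ is an r.i. space with absolutely continuous norm and fundamental function $\phi$. Suppose that any one of the following conditions is satisfied: 1. $X\hookrightarrow M^p_{\rm loc}(X)$; 2. $X\hookrightarrow\Lambda^p_{\psi,{\rm fm}}$; 3. $L^{p,1}(\mathcal P)\hookrightarrow X_{\rm fm}$ and $X\hookrightarrow L^p_{\rm fm}(\mathcal P)$; 4. $\phi(t)^p\fint_0^t\phi(s)^{-p}\,ds$ is bounded on $(0,\delta)$ for some $\delta>0$;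 5. $\phi^q$ is concave on $[0,\delta)$ for some $q>p$ and some $\delta>0$; 6. $\phi(t)^q/t$ is non-increasing on $(0,\delta)$ for some $q>p$ and some $\delta>0$; 7. $m_\phi\in L^p(0,1)$, where $m_\phi(s)=\sup_{0<t<1}\phi(t)/\phi(st)$; 8. $\overline\beta_X<1/p$; 9. $\overline\alpha_X<1/p$. Then Lipschitz functions are dense in $N^1X$: for every $u\in N^1X$ and $\varepsilon>0$ there is a Lipschitz function $v:\mathcal P\to\mathbb R$ in $N^1X$ with $\|u-v\|_{N^1X}<\varepsilon$. -/

import Mathlib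

open MeasureTheory Set Filter Topology
open scoped ENNReal NNReal

noncomputable section

/-! ### Rearrangement-invariant spaces -/

/-- A rearrangement-invariant Banach function space over `(α, μ)`, given by its function norm on
non-negative `μ`-measurable functions. An extended real-valued `μ`-measurable `u` has the norm
`‖u‖_X = X |u|` and lies in `X` iff that is finite. As `μ`-measurability refers to the completion
of `μ`, it is expressed by `AEMeasurable` and `NullMeasurableSet`; values at non-measurable
functions are irrelevant. -/
structure RISpace {α : Type*} [MeasurableSpace α] (μ : Measure α) where
  toFun : (α → ℝ≥0∞) → ℝ≥0∞
  eq_zero_iff : ∀ f, AEMeasurable f μ → (toFun f = 0 ↔ f =ᵐ[μ] 0)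
  smul : ∀ (a : ℝ≥0) (f), AEMeasurable f μ → toFun (fun x => a * f x) = a * toFun f
  add_le : ∀ f g, AEMeasurable f μ → AEMeasurable g μ →
    toFun (fun x => f x + g x) ≤ toFun f + toFun g
  mono : ∀ f g, AEMeasurable f μ → AEMeasurable g μ → f ≤ᵐ[μ] g → toFun f ≤ toFun g
  /-- Fatou property. -/
  fatou : ∀ f : ℕ → α → ℝ≥0∞, (∀ n, AEMeasurable (f n) μ) →
    (∀ᵐ x ∂μ, Monotone fun n => f n x) → toFun (fun x => ⨆ n, f n x) = ⨆ n, toFun (f n)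
  indicator_lt_top : ∀ E, NullMeasurableSet E μ → μ E < ∞ → toFun (E.indicator 1) < ∞
  lintegral_le : ∀ E, NullMeasurableSet E μ → μ E < ∞ →
    ∃ C : ℝ≥0, ∀ f, AEMeasurable f μ → ∫⁻ x in E, f x ∂μ ≤ C * toFun f
  /-- Equimeasurable functions have the same norm. -/
  rearrangement_invariant : ∀ f g, AEMeasurable f μ → AEMeasurable g μ →
    (∀ t : ℝ≥0, μ {x | (t : ℝ≥0∞) < f x} = μ {x | (t : ℝ≥0∞) < g x}) → toFun f = toFun g

instance {α : Type*} [MeasurableSpace α] (μ : Measure α) :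
    CoeFun (RISpace μ) fun _ => (α → ℝ≥0∞) → ℝ≥0∞ := ⟨RISpace.toFun⟩

/-- Absolute continuity of the norm. -/
def RISpace.HasACNorm {α : Type*} [MeasurableSpace α] {μ : Measure α} (X : RISpace μ) : Prop :=
  ∀ f, AEMeasurable f μ → X f < ∞ → ∀ E : ℕ → Set α, (∀ n, NullMeasurableSet (E n) μ) →
    Antitone E → μ (⋂ n, E n) = 0 → Tendsto (fun n => X ((E n).indicator f)) atTop (𝓝 0)

/-- The fundamental function `φ(t) = ‖χ_E‖_X` with `μ E = t` for `0 ≤ t < μ α`, and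
`φ(t) = ‖1‖_X` for `t ≥ μ α`. All sets of the same measure yield the same value. -/
def RISpace.fundamental {α : Type*} [MeasurableSpace α] {μ : Measure α} (X : RISpace μ)
    (t : ℝ) : ℝ≥0∞ :=
  if ENNReal.ofReal t < μ univ then
    ⨆ (E : Set α) (_ : NullMeasurableSet E μ) (_ : μ E = ENNReal.ofReal t), X (E.indicator 1)
  else X 1

/-- The decreasing rearrangement `f^*(t) = inf {s ≥ 0 : μ {f > s} ≤ t}`, for `t ≥ 0`. -/
def rearr {α : Type*} [MeasurableSpace α] (μ : Measure α) (f : α → ℝ≥0∞) (t : ℝ) : ℝ≥0∞ :=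
  sInf {s : ℝ≥0∞ | μ {x | s < f x} ≤ ENNReal.ofReal t}

/-- `(0, ∞)` as a metric space. -/
abbrev RPos : Type := {t : ℝ // 0 < t}

/-- The Lebesgue measure on `(0, ∞)`. -/
def volRPos : Measure RPos := Measure.comap Subtype.val (volume : Measure ℝ)

/-- The norm of the representation space of `X` over `(0, ∞)`: it is determined by
`‖u‖_X = ‖u^*‖` for `u` on `α`, and `‖f‖ = ‖f^* χ_(0, μ α)‖` for `f` on `(0, ∞)`. The infimum is
over a set of `u` on which `‖u‖_X` is constant. -/
def RISpace.reprNorm {α : Type*} [MeasurableSpace α] {μ : Measure α} (X : RISpace μ)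
    (f : RPos → ℝ≥0∞) : ℝ≥0∞ :=
  ⨅ (u : α → ℝ≥0∞) (_ : AEMeasurable u μ)
    (_ : ∀ t : RPos, rearr μ u t =
      if ENNReal.ofReal t < μ univ then rearr volRPos f t else 0), X u

/-- The dilation operator `E_s f(t) = f(s t)`. -/
def dilation (s : RPos) (f : RPos → ℝ≥0∞) : RPos → ℝ≥0∞ := fun t => f (s * t)

/-- `h_X(s) = sup ‖E_{1/s} f‖ / ‖f‖` over the non-zero elements `f` of the representation space. -/
def RISpace.dilationNorm {α : Type*} [MeasurableSpace α] {μ : Measure α} (X : RISpace μ)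
    (s : RPos) : ℝ≥0∞ :=
  ⨆ (f : RPos → ℝ≥0∞) (_ : AEMeasurable f volRPos)
    (_ : X.reprNorm f ≠ 0) (_ : X.reprNorm f < ∞), X.reprNorm (dilation s⁻¹ f) / X.reprNorm f

/-- The upper Boyd index. -/
def RISpace.upperBoydIndex {α : Type*} [MeasurableSpace α] {μ : Measure α} (X : RISpace μ) :
    EReal :=
  ⨅ (s : RPos) (_ : 1 < (s : ℝ)), ENNReal.log (X.dilationNorm s) / (Real.log s : EReal)

/-- The upper fundamental (Zippin) index, with `k_X(s) = sup_{t > 0} φ(st) / φ(t)`. -/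
def RISpace.upperFundamentalIndex {α : Type*} [MeasurableSpace α] {μ : Measure α}
    (X : RISpace μ) : EReal :=
  ⨅ (s : ℝ) (_ : 1 < s),
    ENNReal.log (⨆ (t : ℝ) (_ : 0 < t), X.fundamental (s * t) / X.fundamental t) /
      (Real.log s : EReal)

/-! ### Maximal operator, Marcinkiewicz and Lorentz norms, embeddings -/

/-- The non-centered maximal operator `M_p`. -/
def maximalOp {R : Type*} [PseudoMetricSpace R] [MeasurableSpace R] (ν : Measure R) (p : ℝ)
    (f : R → ℝ≥0∞) (x : R) : ℝ≥0∞ :=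
  ⨆ (c : R) (r : ℝ) (_ : x ∈ Metric.ball c r), (⨍⁻ y in Metric.ball c r, f y ^ p ∂ν) ^ (1 / p)

/-- `‖f‖ = sup_{0<t<1} M_p f^*(t) φ(t)`, the norm of `M^p_{φ,loc}`. -/
def marcinkiewiczLocNorm {α : Type*} [MeasurableSpace α] (μ : Measure α) (p : ℝ)
    (φ : ℝ → ℝ≥0∞) (f : α → ℝ≥0∞) : ℝ≥0∞ :=
  ⨆ (t : RPos) (_ : (t : ℝ) < 1),
    maximalOp volRPos p (fun s => rearr μ f s) t * φ t

/-- `‖f‖ = (∫_0^∞ (f^*(t) ψ(t))^q dt/t)^{1/q}`, the norm of `Λ^q_ψ`. -/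
def lambdaNorm {α : Type*} [MeasurableSpace α] (μ : Measure α) (q : ℝ) (ψ : ℝ → ℝ≥0∞)
    (f : α → ℝ≥0∞) : ℝ≥0∞ :=
  (∫⁻ t in Ioi (0 : ℝ), (rearr μ f t * ψ t) ^ q / ENNReal.ofReal t) ^ (1 / q)

/-- `‖f‖ = ((q/p) ∫_0^∞ (f^*(t) t^{1/p})^q dt/t)^{1/q}`, the norm of `L^{p,q}`, `q < ∞`. -/
def lorentzNorm {α : Type*} [MeasurableSpace α] (μ : Measure α) (p q : ℝ)
    (f : α → ℝ≥0∞) : ℝ≥0∞ :=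
  (ENNReal.ofReal (q / p) *
    ∫⁻ t in Ioi (0 : ℝ), (rearr μ f t * ENNReal.ofReal t ^ (1 / p)) ^ q / ENNReal.ofReal t)
      ^ (1 / q)

/-- `ψ(t) = t^{1/p} sup_{t ≤ s ≤ 1} φ(s) / s^{1/p}` for `0 < t ≤ 1`, `ψ(0) = 0`, and
`ψ(t) = φ(t)` for `t ≥ 1`. -/
def quasiconcaveMajorant (p : ℝ) (φ : ℝ → ℝ≥0∞) (t : ℝ) : ℝ≥0∞ :=
  if t ≤ 0 then 0
  else if t ≤ 1 then
    ENNReal.ofReal t ^ (1 / p) * ⨆ s ∈ Icc t 1, φ s / ENNReal.ofReal s ^ (1 / p)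
  else φ t

/-- `A ↪ B` for function spaces given by their norms. -/
def Embeds {α : Type*} [MeasurableSpace α] (μ : Measure α)
    (A B : (α → ℝ≥0∞) → ℝ≥0∞) : Prop :=
  ∃ c : ℝ≥0, ∀ f, AEMeasurable f μ → A f < ∞ → B f ≤ c * A f

/-- `A ↪ B_fm`: continuous embedding on sets of finite measure. -/
def EmbedsFm {α : Type*} [MeasurableSpace α] (μ : Measure α)
    (A B : (α → ℝ≥0∞) → ℝ≥0∞) : Prop :=
  ∀ E, NullMeasurableSet E μ → μ E < ∞ →
    ∃ c : ℝ≥0, ∀ f, AEMeasurable f μ → A f < ∞ → B (E.indicator f) ≤ c * A f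

/-! ### Metric measure spaces, upper gradients, Newtonian spaces -/

/-- Every ball has finite positive measure. -/
def BallsFinitePos {P : Type*} [PseudoMetricSpace P] [MeasurableSpace P] (μ : Measure P) : Prop :=
  ∀ (x : P) (r : ℝ), 0 < r → 0 < μ (Metric.ball x r) ∧ μ (Metric.ball x r) < ∞

def IsDoubling {P : Type*} [PseudoMetricSpace P] [MeasurableSpace P] (μ : Measure P) : Prop :=
  ∃ C : ℝ≥0, ∀ (x : P) (r : ℝ), 0 < r → μ (Metric.ball x (2 * r)) ≤ C * μ (Metric.ball x r)

/-- `g` is an upper gradient of `u`. Curves are non-constant, rectifiable, and parametrized by arc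
length on `[0, l]`. In `EReal`, `|(±∞) - (±∞)| = ∞` as required. -/
def IsUpperGradient {P : Type*} [PseudoMetricSpace P] [MeasurableSpace P]
    (u : P → EReal) (g : P → ℝ≥0∞) : Prop :=
  Measurable g ∧ ∀ (γ : ℝ → P) (l : ℝ), 0 < l → HasUnitSpeedOn γ (Icc 0 l) →
    (u (γ 0) - u (γ l)).abs ≤ ∫⁻ t in Icc 0 l, g (γ t)

/-- The `p`-Poincaré inequality. -/
def IsPoincareSpace {P : Type*} [PseudoMetricSpace P] [MeasurableSpace P] (μ : Measure P)
    (p : ℝ) : Prop :=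
  ∃ (c : ℝ≥0) (l : ℝ), 0 < c ∧ 1 ≤ l ∧ ∀ (x : P) (r : ℝ), 0 < r →
    ∀ u : P → ℝ, (∀ (y : P) (R : ℝ), IntegrableOn u (Metric.ball y R) μ) →
    ∀ g : P → ℝ≥0∞, IsUpperGradient (fun y => (u y : EReal)) g →
      ⨍⁻ y in Metric.ball x r, ‖u y - ⨍ z in Metric.ball x r, u z ∂μ‖ₑ ∂μ ≤
        c * ENNReal.ofReal (Metric.diam (Metric.ball x r)) *
          (⨍⁻ y in Metric.ball x (l * r), g y ^ p ∂μ) ^ (1 / p)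

/-- `‖u‖_{N¹X} = ‖u‖_X + inf_g ‖g‖_X`, the infimum being over all upper gradients `g` of `u`. -/
def newtonianNorm {P : Type*} [PseudoMetricSpace P] [MeasurableSpace P] {μ : Measure P}
    (X : RISpace μ) (u : P → EReal) : ℝ≥0∞ :=
  X (fun x => (u x).abs) + ⨅ (g : P → ℝ≥0∞) (_ : IsUpperGradient u g), X g

/-- `u ∈ N¹X`. -/
def MemNewtonian {P : Type*} [PseudoMetricSpace P] [MeasurableSpace P] {μ : Measure P}
    (X : RISpace μ) (u : P → EReal) : Prop :=
  AEMeasurable u μ ∧ newtonianNorm X u < ∞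

/-- Lipschitz functions are dense in `N¹X`. -/
def LipschitzDenseInNewtonian {P : Type*} [PseudoMetricSpace P] [MeasurableSpace P]
    {μ : Measure P} (X : RISpace μ) : Prop :=
  ∀ u : P → EReal, MemNewtonian X u → ∀ ε : ℝ≥0∞, 0 < ε →
    ∃ v : P → ℝ, (∃ K : ℝ≥0, LipschitzWith K v) ∧ MemNewtonian X (fun x => (v x : EReal)) ∧
      newtonianNorm X (fun x => u x - (v x : EReal)) < ε

end

/-!
Each of the nine conditions implies that, on sets `E` of small measure, the `L^p` mean of a function
over `E` is at most a constant times `‖f χ_E‖ / ‖χ_E‖` in `X`.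

By truncation `u` may be taken bounded; let `g` be an upper gradient of `u` in `X`, and let `A` be
the set where `g > a` or the maximal function of `g^p χ_{g > a}` exceeds `a^p`. The weak type
inequality for the maximal function, the control of `L^p` means and the absolute continuity of the
norm give `a ‖χ_A‖ → 0` as `a → ∞`. At almost every point off `A` the Poincaré inequality,
telescoped over shrinking balls, makes `u` Lipschitz with a constant comparable to `a`; let `v` be
a bounded Lipschitz extension. As `u - v` vanishes off `A`, it has, up to an arbitrarily small
error, an upper gradient comparable to `(g + a) χ_A`, whose norm is small.
-/

noncomputable section

open Metric

/-! ### Doubling metric measure spaces -/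

section Doubling

variable {P : Type*} [PseudoMetricSpace P] [MeasurableSpace P] {μ : Measure P}

/-- `μ` is doubling with the explicit constant `C`. -/
def IsDoublingWith (μ : Measure P) (C : ℝ≥0) : Prop :=
  ∀ (x : P) (r : ℝ), 0 < r → μ (ball x (2 * r)) ≤ C * μ (ball x r)

/-- `u` is integrable on balls, the class of functions for which integral means over balls, and
hence the Poincaré inequality, make sense. -/
def IntegrableOnBalls (u : P → ℝ) (μ : Measure P) : Prop :=
  ∀ (x : P) (r : ℝ), IntegrableOn u (ball x r) μ

/-- `x` is a Lebesgue point of `u`: the integral means of `u` over balls shrinking to `x` converge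
to `u x`. -/
def IsLebesguePoint (μ : Measure P) (u : P → ℝ) (x : P) : Prop :=
  Tendsto (fun r : ℝ => ⨍ y in ball x r, u y ∂μ) (𝓝[>] 0) (𝓝 (u x))

/-- The mean oscillation of `u` over every ball centered at `x` is at most `A` times its radius. -/
def HasLinearOscillationAt (μ : Measure P) (u : P → ℝ) (A : ℝ) (x : P) : Prop :=
  ∀ r > 0, ⨍ y in ball x r, |u y - ⨍ z in ball x r, u z ∂μ| ∂μ ≤ A * r

/-- The set where the centered Hardy–Littlewood maximal function of `H` exceeds `a`, written
without division. -/
def maximalSuperlevel (μ : Measure P) (H : P → ℝ≥0∞) (a : ℝ≥0∞) : Set P :=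
  {x | ∃ r > 0, a * μ (ball x r) < ∫⁻ y in ball x r, H y ∂μ}

theorem BallsFinitePos.sigmaFinite (hball : BallsFinitePos μ) : SigmaFinite μ := by
  rcases isEmpty_or_nonempty P with hP | ⟨⟨x₀⟩⟩
  · rw [Measure.eq_zero_of_isEmpty μ]
    infer_instance
  · refine ⟨⟨⟨fun n : ℕ => ball x₀ (n + 1), fun _ => trivial,
      fun n => (hball x₀ _ (by positivity)).2, eq_univ_of_forall fun x => mem_iUnion.2 ?_⟩⟩⟩
    obtain ⟨n, hn⟩ := exists_nat_gt (dist x x₀)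
    exact ⟨n, by rw [mem_ball]; linarith⟩

theorem BallsFinitePos.isLocallyFiniteMeasure (hball : BallsFinitePos μ) :
    IsLocallyFiniteMeasure μ :=
  ⟨fun x => ⟨ball x 1, ball_mem_nhds x one_pos, (hball x 1 one_pos).2⟩⟩

theorem BallsFinitePos.countable_of_pairwiseDisjoint [OpensMeasurableSpace P]
    (hball : BallsFinitePos μ) {u : Set P} {r : P → ℝ} (hr : ∀ x ∈ u, 0 < r x)
    (hu : u.PairwiseDisjoint fun x => ball x (r x)) : u.Countable := by
  have := hball.sigmaFinite
  have hcount : Set.Countable {x : u | 0 < μ (ball (x : P) (r x))} :=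
    Measure.countable_meas_pos_of_disjoint_iUnion (fun _ => isOpen_ball.measurableSet)
      ((pairwise_subtype_iff_pairwise_set u _).2 hu)
  have huniv : {x : u | 0 < μ (ball (x : P) (r x))} = univ :=
    eq_univ_of_forall fun x => (hball x _ (hr x x.2)).1
  rw [huniv] at hcount
  exact countable_coe_iff.1 (countable_univ_iff.1 hcount)

theorem BallsFinitePos.secondCountableTopology [OpensMeasurableSpace P]
    (hball : BallsFinitePos μ) : SecondCountableTopology P := by
  refine secondCountable_of_almost_dense_set fun ε hε => ?_
  obtain ⟨u, -, hu, hcov⟩ := Vitali.exists_disjoint_subfamily_covering_enlargement_closedBall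
    (univ : Set P) (fun x => x) (fun _ => ε / 5) (ε / 5) (fun _ _ => le_rfl) 5 (by norm_num)
  refine ⟨u, hball.countable_of_pairwiseDisjoint (r := fun _ => ε / 5) (fun _ _ => by positivity)
    (hu.mono fun _ => ball_subset_closedBall), fun x => ?_⟩
  obtain ⟨y, hy, hxy⟩ := hcov x (mem_univ x)
  refine ⟨y, hy, ?_⟩
  have := mem_closedBall.1 (hxy (mem_closedBall_self (by positivity)))
  linarith

theorem IsDoublingWith.measure_ball_two_pow_mul_le {C : ℝ≥0} (hC : IsDoublingWith μ C) (x : P)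
    {r : ℝ} (hr : 0 < r) (n : ℕ) : μ (ball x (2 ^ n * r)) ≤ C ^ n * μ (ball x r) := by
  induction n with
  | zero => simp
  | succ n ih =>
    calc μ (ball x (2 ^ (n + 1) * r)) = μ (ball x (2 * (2 ^ n * r))) := by rw [pow_succ']; ring_nf
      _ ≤ C * (C ^ n * μ (ball x r)) := (hC x _ (by positivity)).trans (by gcongr)
      _ = C ^ (n + 1) * μ (ball x r) := by ring

theorem IsDoublingWith.isUnifLocDoublingMeasure {C : ℝ≥0} (hC : IsDoublingWith μ C) :
    IsUnifLocDoublingMeasure μ := by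
  refine ⟨C ^ 2, ?_⟩
  filter_upwards [self_mem_nhdsWithin] with r (hr : 0 < r) x
  calc μ (closedBall x (2 * r)) ≤ μ (ball x (2 ^ 2 * r)) :=
        measure_mono (closedBall_subset_ball (by linarith))
    _ ≤ C ^ 2 * μ (ball x r) := hC.measure_ball_two_pow_mul_le x hr 2
    _ ≤ (C ^ 2 : ℝ≥0) * μ (closedBall x r) := by
        push_cast
        gcongr
        exact ball_subset_closedBall

theorem IsDoublingWith.exists_disjoint_balls_measure_le [OpensMeasurableSpace P]
    (hball : BallsFinitePos μ) {C : ℝ≥0} (hC : IsDoublingWith μ C) {S : Set P} {r : P → ℝ} {R : ℝ}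
    (hr : ∀ x ∈ S, 0 < r x) (hR : ∀ x ∈ S, r x ≤ R) :
    ∃ u ⊆ S, u.Countable ∧ (u.PairwiseDisjoint fun x => ball x (r x)) ∧
      μ S ≤ C ^ 3 * ∑' x : u, μ (ball (x : P) (r x)) := by
  obtain ⟨u, huS, hu, hcov⟩ := Vitali.exists_disjoint_subfamily_covering_enlargement_closedBall
    S (fun x => x) r R hR 5 (by norm_num)
  have hdisj : u.PairwiseDisjoint fun x => ball x (r x) := hu.mono fun _ => ball_subset_closedBall
  have hcount := hball.countable_of_pairwiseDisjoint (fun x hx => hr x (huS hx)) hdisj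
  have hsub : S ⊆ ⋃ y ∈ u, ball y (2 ^ 3 * r y) := by
    intro x hx
    obtain ⟨y, hy, hxy⟩ := hcov x hx
    have hry := hr y (huS hy)
    exact mem_biUnion hy (closedBall_subset_ball (by linarith)
      (hxy (mem_closedBall_self (hr x hx).le)))
  refine ⟨u, huS, hcount, hdisj, ?_⟩
  have := hcount.to_subtype
  calc μ S ≤ ∑' y : u, μ (ball (y : P) (2 ^ 3 * r y)) :=
        (measure_mono hsub).trans (measure_biUnion_le _ hcount _)
    _ ≤ ∑' y : u, C ^ 3 * μ (ball (y : P) (r y)) :=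
        ENNReal.tsum_le_tsum fun y => hC.measure_ball_two_pow_mul_le _ (hr y (huS y.2)) 3
    _ = C ^ 3 * ∑' y : u, μ (ball (y : P) (r y)) := ENNReal.tsum_mul_left

theorem IsDoublingWith.mul_measure_le_lintegral_of_bounded_radii [OpensMeasurableSpace P]
    (hball : BallsFinitePos μ) {C : ℝ≥0} (hC : IsDoublingWith μ C) {H : P → ℝ≥0∞} {a : ℝ≥0∞}
    {S : Set P} {R : ℝ}
    (hS : ∀ x ∈ S, ∃ r : ℝ, 0 < r ∧ r ≤ R ∧ a * μ (ball x r) ≤ ∫⁻ y in ball x r, H y ∂μ) :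
    a * μ S ≤ C ^ 3 * ∫⁻ y, H y ∂μ := by
  choose! r hrpos hrR hr using hS
  obtain ⟨u, huS, hcount, hdisj, hμS⟩ := hC.exists_disjoint_balls_measure_le hball hrpos hrR
  have := hcount.to_subtype
  calc a * μ S ≤ a * (C ^ 3 * ∑' y : u, μ (ball (y : P) (r y))) := by gcongr
    _ = C ^ 3 * ∑' y : u, a * μ (ball (y : P) (r y)) := by rw [ENNReal.tsum_mul_left]; ring
    _ ≤ C ^ 3 * ∑' y : u, ∫⁻ z in ball (y : P) (r y), H z ∂μ := by
        gcongr with y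
        exact hr y (huS y.2)
    _ = C ^ 3 * ∫⁻ z in ⋃ y : u, ball (y : P) (r y), H z ∂μ := by
        rw [lintegral_iUnion (fun _ => isOpen_ball.measurableSet)
          ((pairwise_subtype_iff_pairwise_set u _).2 hdisj)]
    _ ≤ C ^ 3 * ∫⁻ y, H y ∂μ := by
        gcongr
        exact Measure.restrict_le_self

theorem IsDoublingWith.mul_measure_maximalSuperlevel_le [OpensMeasurableSpace P]
    (hball : BallsFinitePos μ) {C : ℝ≥0} (hC : IsDoublingWith μ C) (H : P → ℝ≥0∞) (a : ℝ≥0∞) :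
    a * μ (maximalSuperlevel μ H a) ≤ C ^ 3 * ∫⁻ y, H y ∂μ := by
  let S : ℕ → Set P := fun n =>
    {x | ∃ r : ℝ, 0 < r ∧ r ≤ n ∧ a * μ (ball x r) < ∫⁻ y in ball x r, H y ∂μ}
  have hmono : Monotone S := fun m n hmn x ⟨r, hr, hrm, hlt⟩ =>
    ⟨r, hr, hrm.trans (by exact_mod_cast hmn), hlt⟩
  have hunion : maximalSuperlevel μ H a ⊆ ⋃ n, S n := fun x ⟨r, hr, hlt⟩ =>
    let ⟨n, hn⟩ := exists_nat_ge r
    mem_iUnion.2 ⟨n, r, hr, hn, hlt⟩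
  calc a * μ (maximalSuperlevel μ H a) ≤ a * μ (⋃ n, S n) := by gcongr
    _ = ⨆ n, a * μ (S n) := by rw [hmono.measure_iUnion, ENNReal.mul_iSup]
    _ ≤ C ^ 3 * ∫⁻ y, H y ∂μ := iSup_le fun n =>
        hC.mul_measure_le_lintegral_of_bounded_radii hball fun x ⟨r, hr, hrn, hlt⟩ =>
          ⟨r, hr, hrn, hlt.le⟩

end Doubling

/-! ### Lebesgue points and mean oscillation -/

theorem abs_setAverage_sub_le_mul_setAverage {α : Type*} [MeasurableSpace α] {μ : Measure α}
    {B B' : Set α} (hB' : B' ⊆ B) (hpos : 0 < μ B') (hfin : μ B < ∞) {K : ℝ≥0}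
    (hK : μ B ≤ K * μ B') {u : α → ℝ} (hu : IntegrableOn u B μ) (a : ℝ) :
    |(⨍ y in B', u y ∂μ) - a| ≤ K * ⨍ y in B, |u y - a| ∂μ := by
  have hfin' : μ B' < ∞ := (measure_mono hB').trans_lt hfin
  have hpos' : 0 < μ.real B' := ENNReal.toReal_pos hpos.ne' hfin'.ne
  have hreal : μ.real B ≤ K * μ.real B' := by
    simpa [Measure.real] using
      ENNReal.toReal_mono (ENNReal.mul_ne_top ENNReal.coe_ne_top hfin'.ne) hK
  have hposB : 0 < μ.real B := hpos'.trans_le (measureReal_mono hB' hfin.ne)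
  have hint : IntegrableOn (fun y => u y - a) B μ := hu.sub (integrableOn_const hfin.ne)
  have hbound : |∫ y in B', (u y - a) ∂μ| ≤ ∫ y in B, |u y - a| ∂μ :=
    abs_integral_le_integral_abs.trans (setIntegral_mono_set hint.abs
      (Eventually.of_forall fun _ => abs_nonneg _) hB'.eventuallyLE)
  calc |(⨍ y in B', u y ∂μ) - a| = (μ.real B')⁻¹ * |∫ y in B', (u y - a) ∂μ| := by
        rw [← abs_of_pos (inv_pos.2 hpos'), ← abs_mul,
          integral_sub (hu.mono_set hB') (integrableOn_const hfin'.ne), setAverage_eq, smul_eq_mul,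
          setIntegral_const, smul_eq_mul]
        congr 1
        field_simp
    _ ≤ (K * (μ.real B)⁻¹) * ∫ y in B, |u y - a| ∂μ := by
        gcongr
        rw [← div_eq_mul_inv, inv_eq_one_div, div_le_div_iff₀ hpos' hposB]
        linarith
    _ = K * ⨍ y in B, |u y - a| ∂μ := by rw [setAverage_eq, smul_eq_mul, mul_assoc]

section Oscillation

variable {P : Type*} [PseudoMetricSpace P] [MeasurableSpace P] {μ : Measure P} {C : ℝ≥0}
  {u : P → ℝ}

theorem IntegrableOnBalls.ae_isLebesguePoint [BorelSpace P] (hu : IntegrableOnBalls u μ)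
    (hball : BallsFinitePos μ) (hC : IsDoublingWith μ C) : ∀ᵐ x ∂μ, IsLebesguePoint μ u x := by
  have := hball.secondCountableTopology
  have := hball.isLocallyFiniteMeasure
  have := hC.isUnifLocDoublingMeasure
  have hloc : LocallyIntegrable u μ := fun x => ⟨ball x 1, ball_mem_nhds x one_pos, hu x 1⟩
  filter_upwards [IsUnifLocDoublingMeasure.ae_tendsto_average_norm_sub μ hloc 1] with x hx
  have hclosed : Tendsto (fun r : ℝ => ⨍ y in closedBall x r, ‖u y - u x‖ ∂μ) (𝓝[>] 0) (𝓝 0) := by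
    refine hx (fun _ => x) (fun r => r) tendsto_id ?_
    filter_upwards [self_mem_nhdsWithin] with r (hr : 0 < r)
    exact mem_closedBall_self (by simpa using hr.le)
  refine tendsto_iff_dist_tendsto_zero.2 (squeeze_zero' (Eventually.of_forall fun _ => dist_nonneg)
    ?_ (by simpa using hclosed.const_mul (C : ℝ)))
  filter_upwards [self_mem_nhdsWithin] with r (hr : 0 < r)
  have hsub : closedBall x r ⊆ ball x (2 * r) := closedBall_subset_ball (by linarith)
  exact abs_setAverage_sub_le_mul_setAverage ball_subset_closedBall (hball x r hr).1
    ((measure_mono hsub).trans_lt (hball x _ (by positivity)).2)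
    ((measure_mono hsub).trans (hC x r hr)) ((hu x (2 * r)).mono_set hsub) _

-- Telescoping over the balls of radius `r / 2 ^ n`.
theorem IsLebesguePoint.abs_setAverage_ball_sub_le {A : ℝ} {x : P} (hx : IsLebesguePoint μ u x)
    (hball : BallsFinitePos μ) (hC : IsDoublingWith μ C) (hu : IntegrableOnBalls u μ)
    (hosc : HasLinearOscillationAt μ u A x) {r : ℝ} (hr : 0 < r) :
    |(⨍ y in ball x r, u y ∂μ) - u x| ≤ 2 * C * A * r := by
  let mean : ℕ → ℝ := fun n => ⨍ y in ball x (r / 2 ^ n), u y ∂μ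
  have hradius : Tendsto (fun n : ℕ => r / 2 ^ n) atTop (𝓝 0) := by
    simpa [div_eq_mul_inv] using (tendsto_pow_atTop_nhds_zero_of_lt_one (r := (1 / 2 : ℝ))
      (by norm_num) (by norm_num)).const_mul r
  have hlim : Tendsto mean atTop (𝓝 (u x)) := Tendsto.comp hx
    (tendsto_nhdsWithin_iff.2 ⟨hradius, Eventually.of_forall fun n => div_pos hr (by positivity)⟩)
  have hstep (n : ℕ) : dist (mean n) (mean (n + 1)) ≤ 2 * C * A * r / 2 / 2 ^ n := by
    have hrn : 0 < r / 2 ^ (n + 1) := by positivity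
    have hrn' : 0 < r / 2 ^ n := by positivity
    have htwice : 2 * (r / 2 ^ (n + 1)) = r / 2 ^ n := by rw [pow_succ]; field_simp
    have hmeas : μ (ball x (r / 2 ^ n)) ≤ C * μ (ball x (r / 2 ^ (n + 1))) := by
      simpa only [htwice] using hC x _ hrn
    calc dist (mean n) (mean (n + 1)) = |mean (n + 1) - mean n| := by rw [dist_comm, Real.dist_eq]
      _ ≤ C * ⨍ y in ball x (r / 2 ^ n), |u y - mean n| ∂μ :=
          abs_setAverage_sub_le_mul_setAverage (ball_subset_ball (by linarith)) (hball x _ hrn).1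
            (hball x _ hrn').2 hmeas (hu x _) _
      _ ≤ C * (A * (r / 2 ^ n)) := mul_le_mul_of_nonneg_left (hosc _ hrn') C.2
      _ = 2 * C * A * r / 2 / 2 ^ n := by field_simp
  simpa [mean, Real.dist_eq] using dist_le_of_le_geometric_two_of_tendsto₀ hstep hlim

theorem IsLebesguePoint.abs_sub_le {A : ℝ} {x y : P} (hx : IsLebesguePoint μ u x)
    (hy : IsLebesguePoint μ u y) (hball : BallsFinitePos μ) (hC : IsDoublingWith μ C)
    (hu : IntegrableOnBalls u μ) (hxosc : HasLinearOscillationAt μ u A x)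
    (hyosc : HasLinearOscillationAt μ u A y) :
    |u x - u y| ≤ (6 * C + 2 * C ^ 2) * A * dist x y := by
  rcases (dist_nonneg (x := x) (y := y)).eq_or_lt' with hd | hd
  · have hballs (r : ℝ) : ball x r = ball y r :=
      (ball_subset_ball' (by simp [hd])).antisymm (ball_subset_ball' (by simp [dist_comm y x, hd]))
    have hxy : u x = u y :=
      tendsto_nhds_unique hx (by simpa only [hballs, IsLebesguePoint] using hy)
    simp [hxy, hd]
  set d := dist x y
  have hsub : ball y d ⊆ ball x (2 * d) := ball_subset_ball' (by rw [dist_comm y x]; linarith)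
  have hsub' : ball x (2 * d) ⊆ ball y (2 ^ 2 * d) := ball_subset_ball' (by linarith)
  have hmeas : μ (ball x (2 * d)) ≤ (C ^ 2 : ℝ≥0) * μ (ball y d) := by
    push_cast
    exact (measure_mono hsub').trans (hC.measure_ball_two_pow_mul_le y hd 2)
  have hmeanx := hx.abs_setAverage_ball_sub_le hball hC hu hxosc (r := 2 * d) (by positivity)
  have hmeany := hy.abs_setAverage_ball_sub_le hball hC hu hyosc hd
  have hmeans := calc
    |(⨍ z in ball y d, u z ∂μ) - ⨍ z in ball x (2 * d), u z ∂μ|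
      ≤ (C ^ 2 : ℝ≥0) * ⨍ w in ball x (2 * d), |u w - ⨍ z in ball x (2 * d), u z ∂μ| ∂μ :=
        abs_setAverage_sub_le_mul_setAverage hsub (hball y _ hd).1 (hball x _ (by positivity)).2
          hmeas (hu x _) _
    _ ≤ (C ^ 2 : ℝ≥0) * (A * (2 * d)) :=
        mul_le_mul_of_nonneg_left (hxosc (2 * d) (by positivity)) (NNReal.coe_nonneg _)
  push_cast at hmeans
  rw [abs_le] at *
  constructor <;> linarith [hmeanx.1, hmeanx.2, hmeany.1, hmeany.2, hmeans.1, hmeans.2]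

end Oscillation

/-! ### Subsets of prescribed measure -/

theorem continuous_measureReal_Iic (ν : Measure ℝ) [IsFiniteMeasure ν] [NullSingletonClass ν] :
    Continuous fun b => ν.real (Iic b) := by
  have hprim : Continuous fun b : ℝ => ∫ _ in (0 : ℝ)..b, (1 : ℝ) ∂ν :=
    intervalIntegral.continuous_primitive (fun _ _ => intervalIntegrable_const) 0
  simp only [intervalIntegral.integral_const_of_cdf, smul_eq_mul, mul_one] at hprim
  exact (hprim.add continuous_const).congr fun b => sub_add_cancel _ (ν.real (Iic 0))

theorem exists_measure_Iic_eq (ν : Measure ℝ) [IsFiniteMeasure ν] [NullSingletonClass ν]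
    {s : ℝ≥0∞} (hs : 0 < s) (hs' : s < ν univ) : ∃ a, ν (Iic a) = s := by
  have hbot : Tendsto (fun a => ν (Iic a)) atBot (𝓝 0) := by
    have hempty : ⋂ a : ℝ, Iic a = ∅ := iInter_eq_empty_iff.2 fun x => ⟨x - 1, by simp⟩
    simpa [hempty, Function.comp_def] using tendsto_measure_iInter_atBot (μ := ν)
      (fun a : ℝ => measurableSet_Iic.nullMeasurableSet) monotone_Iic ⟨0, measure_ne_top ν _⟩
  obtain ⟨b, hb⟩ := (hbot.eventually (gt_mem_nhds hs)).exists
  obtain ⟨c, hc⟩ := ((tendsto_measure_Iic_atTop ν).eventually (lt_mem_nhds hs')).exists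
  obtain ⟨a, ha⟩ := mem_range_of_exists_le_of_exists_ge (continuous_measureReal_Iic ν)
    (c := s.toReal) ⟨b, ENNReal.toReal_mono hs'.ne_top hb.le⟩
    ⟨c, ENNReal.toReal_mono (measure_ne_top ν _) hc.le⟩
  exact ⟨a, (ENNReal.toReal_eq_toReal_iff' (measure_ne_top ν _) hs'.ne_top).1 ha⟩

-- A measurable injection into `ℝ` reduces this to the continuity of distribution functions.
theorem exists_subset_measure_eq {α : Type*} [MeasurableSpace α]
    [MeasurableSpace.CountablySeparated α] {μ : Measure α} [SigmaFinite μ] [NullSingletonClass μ]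
    {G : Set α} (hG : NullMeasurableSet G μ) {s : ℝ≥0∞} (hs : s ≤ μ G) :
    ∃ F ⊆ G, NullMeasurableSet F μ ∧ μ F = s := by
  rcases hs.eq_or_lt with rfl | hs
  · exact ⟨G, subset_rfl, hG, rfl⟩
  rcases eq_zero_or_pos s with rfl | hpos
  · exact ⟨∅, empty_subset _, nullMeasurableSet_empty, measure_empty⟩
  obtain ⟨G₀, hG₀, hmeas, heq⟩ := hG.exists_measurable_subset_ae_eq
  obtain ⟨G₁, hG₁m, hG₁, hlt, hfin⟩ :=
    Measure.exists_subset_measure_lt_top hmeas (by rwa [measure_congr heq])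
  obtain ⟨e, he, hinj⟩ : ∃ e : α → ℝ, Measurable e ∧ Function.Injective e := by
    obtain ⟨f, hf, hfinj⟩ := MeasurableSpace.measurable_injection_nat_bool_of_countablySeparated α
    have hemb := measurableEmbedding_embeddingReal (ℕ → Bool)
    exact ⟨_, hemb.measurable.comp hf, hemb.injective.comp hfinj⟩
  let ν := (μ.restrict G₁).map e
  have : IsFiniteMeasure (μ.restrict G₁) := ⟨by simpa using hfin⟩
  have : NullSingletonClass ν := ⟨fun x => by
    rw [Measure.map_apply he (measurableSet_singleton x)]
    exact (subsingleton_singleton.preimage hinj).measure_zero _⟩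
  obtain ⟨a, ha⟩ := exists_measure_Iic_eq ν hpos (by
    rwa [Measure.map_apply he MeasurableSet.univ, preimage_univ, Measure.restrict_apply_univ])
  rw [Measure.map_apply he measurableSet_Iic, Measure.restrict_apply (he measurableSet_Iic)] at ha
  exact ⟨_, inter_subset_right.trans (hG₁.trans hG₀),
    ((he measurableSet_Iic).inter hG₁m).nullMeasurableSet, ha⟩

/-! ### Absolute values and truncations of extended reals -/

theorem measurable_ereal_abs : Measurable EReal.abs := by
  refine EReal.measurable_of_measurable_real ?_
  simp only [EReal.abs_def]
  fun_prop

theorem ereal_abs_coe_sub_coe (a b : ℝ) :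
    ((a : EReal) - (b : EReal)).abs = ENNReal.ofReal |a - b| := by
  rw [← EReal.coe_sub, EReal.abs_def]

theorem exists_real_of_ereal_abs_sub_lt_top {a b : EReal} (h : (a - b).abs < ∞) :
    ∃ x y : ℝ, a = x ∧ b = y := by
  induction a <;> induction b <;> simp_all

theorem ereal_abs_add_coe_sub_add_coe_le (a b : EReal) (x y : ℝ) :
    ((a + x) - (b + y)).abs ≤ (a - b).abs + ((x : EReal) - y).abs := by
  by_cases h : (a - b).abs < ∞
  · obtain ⟨c, d, rfl, rfl⟩ := exists_real_of_ereal_abs_sub_lt_top h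
    rw [← EReal.coe_add, ← EReal.coe_add, ereal_abs_coe_sub_coe, ereal_abs_coe_sub_coe,
      ereal_abs_coe_sub_coe, ← ENNReal.ofReal_add (abs_nonneg _) (abs_nonneg _)]
    refine ENNReal.ofReal_le_ofReal ?_
    rw [add_sub_add_comm]
    exact abs_add_le _ _
  · rw [not_lt_top_iff.1 h, top_add]
    exact le_top

theorem ereal_abs_add_coe_le (a : EReal) (x : ℝ) : (a + x).abs ≤ a.abs + (x : EReal).abs := by
  simpa using ereal_abs_add_coe_sub_add_coe_le a 0 x 0

/-- The truncation of an extended real number at the levels `±k`. -/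
def truncateEReal (k : ℝ≥0) (a : EReal) : ℝ :=
  (max (((-k : ℝ) : EReal)) (min ((k : ℝ) : EReal) a)).toReal

section Truncation

variable (k : ℝ≥0)

theorem truncateEReal_coe (a : ℝ) : truncateEReal k a = max (-k : ℝ) (min k a) := by
  rw [truncateEReal, ← EReal.coe_strictMono.monotone.map_min,
    ← EReal.coe_strictMono.monotone.map_max, EReal.toReal_coe]

theorem truncateEReal_top : truncateEReal k ⊤ = k := by
  have hk : ((-k : ℝ) : EReal) ≤ ((k : ℝ) : EReal) := EReal.coe_le_coe_iff.2 (by linarith [k.2])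
  rw [truncateEReal, min_top_right, max_eq_right hk, EReal.toReal_coe]

theorem truncateEReal_bot : truncateEReal k ⊥ = -k := by
  rw [truncateEReal, min_bot_right, max_bot_right, EReal.toReal_coe]

theorem measurable_truncateEReal : Measurable (truncateEReal k) :=
  (measurable_const.max (measurable_const.min measurable_id)).ereal_toReal

theorem abs_truncateEReal_le (a : EReal) : |truncateEReal k a| ≤ k := by
  have hk : (0 : ℝ) ≤ k := k.coe_nonneg
  induction a with
  | bot => rw [truncateEReal_bot, abs_neg, abs_of_nonneg hk]
  | top => rw [truncateEReal_top, abs_of_nonneg hk]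
  | coe a =>
    rw [truncateEReal_coe]
    exact abs_le.2 ⟨le_max_left _ _, max_le (by linarith) (min_le_left _ _)⟩

theorem abs_truncateEReal_coe_sub_le (x y : ℝ) :
    |truncateEReal k x - truncateEReal k y| ≤ |x - y| := by
  rw [truncateEReal_coe, truncateEReal_coe]
  exact abs_projIcc_sub_projIcc (neg_le_self k.coe_nonneg)

theorem ereal_abs_truncateEReal_sub_le (a b : EReal) :
    ((truncateEReal k a : EReal) - truncateEReal k b).abs ≤ (a - b).abs := by
  by_cases h : (a - b).abs < ∞
  · obtain ⟨x, y, rfl, rfl⟩ := exists_real_of_ereal_abs_sub_lt_top h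
    rw [ereal_abs_coe_sub_coe, ereal_abs_coe_sub_coe]
    exact ENNReal.ofReal_le_ofReal (abs_truncateEReal_coe_sub_le k x y)
  · rw [not_lt_top_iff.1 h]
    exact le_top

theorem ereal_abs_truncateEReal_le (a : EReal) : (truncateEReal k a : EReal).abs ≤ a.abs := by
  have hzero : truncateEReal k 0 = 0 := by simpa using truncateEReal_coe k 0
  simpa [hzero] using ereal_abs_truncateEReal_sub_le k a 0

theorem ereal_abs_sub_truncateEReal_sub_le (a b : EReal) :
    ((a - truncateEReal k a) - (b - truncateEReal k b)).abs ≤ (a - b).abs := by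
  by_cases h : (a - b).abs < ∞
  · obtain ⟨x, y, rfl, rfl⟩ := exists_real_of_ereal_abs_sub_lt_top h
    rw [← EReal.coe_sub, ← EReal.coe_sub, ereal_abs_coe_sub_coe, ereal_abs_coe_sub_coe]
    refine ENNReal.ofReal_le_ofReal ?_
    clear h
    wlog hyx : y ≤ x generalizing x y
    · rw [abs_sub_comm, abs_sub_comm x]
      exact this y x (le_of_not_ge hyx)
    have hmono : truncateEReal k y ≤ truncateEReal k x := by
      rw [truncateEReal_coe, truncateEReal_coe]
      gcongr
    have hcontr := abs_truncateEReal_coe_sub_le k x y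
    rw [abs_of_nonneg (sub_nonneg.2 hmono), abs_of_nonneg (sub_nonneg.2 hyx)] at hcontr
    rw [abs_of_nonneg (sub_nonneg.2 hyx), abs_of_nonneg] <;> linarith
  · rw [not_lt_top_iff.1 h]
    exact le_top

theorem sub_truncateEReal_eq_zero {a : EReal} (h : a.abs ≤ k) : a - truncateEReal k a = 0 := by
  induction a with
  | bot => simp at h
  | top => simp at h
  | coe a =>
    rw [EReal.abs_def, ← ENNReal.ofReal_coe_nnreal, ENNReal.ofReal_le_ofReal_iff k.coe_nonneg,
      abs_le] at h
    rw [truncateEReal_coe, min_eq_right h.2, max_eq_right h.1, ← EReal.coe_sub, sub_self,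
      EReal.coe_zero]

theorem ereal_abs_sub_truncateEReal_le (a : EReal) : (a - truncateEReal k a).abs ≤ a.abs := by
  simpa [sub_truncateEReal_eq_zero k (a := 0) (by simp)] using
    ereal_abs_sub_truncateEReal_sub_le k a 0

theorem sub_truncateEReal_add_coe (a : EReal) (b : ℝ) :
    (a - truncateEReal k a) + ((truncateEReal k a - b : ℝ) : EReal) = a - b := by
  induction a with
  | bot => simp
  | top => rw [EReal.top_sub_coe, EReal.top_sub_coe, EReal.top_add_coe]
  | coe a => norm_cast; ring

end Truncation

/-! ### Functions on an interval controlled by an integral -/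

section ControlledByIntegral

variable {W : ℝ → ℝ} {h κ : ℝ → ℝ≥0∞} {a b : ℝ}

theorem continuousOn_of_abs_sub_le_lintegral
    (hW : ∀ s ∈ Icc a b, ∀ t ∈ Icc a b, s ≤ t → ENNReal.ofReal |W s - W t| ≤ ∫⁻ r in Icc s t, h r)
    (hfin : ∫⁻ r in Icc a b, h r ≠ ∞) : ContinuousOn W (Icc a b) := by
  refine Metric.continuousOn_iff.2 fun t ht ε hε => ?_
  obtain ⟨δ, hδ, hδε⟩ := exists_pos_setLIntegral_lt_of_measure_lt hfin
    (ENNReal.ofReal_pos.2 hε).ne'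
  have hmin : min δ 1 ≠ ∞ := ne_top_of_le_ne_top ENNReal.one_ne_top (min_le_right _ _)
  have hclose : ∀ r ∈ Icc a b, ∀ s ∈ Icc a b, r ≤ s → |r - s| < (min δ 1).toReal →
      |W r - W s| < ε := by
    intro r hr s hs hrs hlt
    have hsmall : volume.restrict (Icc a b) (Icc r s) < δ := by
      refine ((Measure.restrict_apply_le _ _).trans_lt ?_).trans_le (min_le_left δ 1)
      rw [abs_sub_comm, abs_of_nonneg (sub_nonneg.2 hrs)] at hlt
      rw [Real.volume_Icc]
      exact (ENNReal.ofReal_lt_iff_lt_toReal (sub_nonneg.2 hrs) hmin).2 hlt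
    have hint := hδε _ hsmall
    rw [Measure.restrict_restrict measurableSet_Icc,
      inter_eq_self_of_subset_left (Icc_subset_Icc hr.1 hs.2)] at hint
    exact (ENNReal.ofReal_lt_ofReal_iff hε).1 ((hW r hr s hs hrs).trans_lt hint)
  refine ⟨(min δ 1).toReal, ENNReal.toReal_pos (by positivity) hmin, fun s hs hst => ?_⟩
  rw [Real.dist_eq] at hst ⊢
  rcases le_total s t with hle | hle
  · exact hclose s hs t ht hle hst
  · rw [abs_sub_comm] at hst ⊢
    exact hclose t ht s hs hle hst

-- Between its first and its last zero `W` makes no net change, so only the two zero-free end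
-- pieces count, and there `h ≤ κ`.
theorem abs_sub_le_lintegral_of_le_where_ne_zero (hab : a ≤ b)
    (hW : ∀ s ∈ Icc a b, ∀ t ∈ Icc a b, s ≤ t → ENNReal.ofReal |W s - W t| ≤ ∫⁻ r in Icc s t, h r)
    (hfin : ∫⁻ r in Icc a b, h r ≠ ∞) (hκ : ∀ r ∈ Icc a b, W r ≠ 0 → h r ≤ κ r) :
    ENNReal.ofReal |W a - W b| ≤ ∫⁻ r in Icc a b, κ r := by
  have ha : a ∈ Icc a b := left_mem_Icc.2 hab
  have hb : b ∈ Icc a b := right_mem_Icc.2 hab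
  have hpiece : ∀ s ∈ Icc a b, ∀ t ∈ Icc a b, s ≤ t → (∀ r ∈ Ioo s t, W r ≠ 0) →
      ENNReal.ofReal |W s - W t| ≤ ∫⁻ r in Ioo s t, κ r := fun s hs t ht hst hne => calc
    ENNReal.ofReal |W s - W t| ≤ ∫⁻ r in Icc s t, h r := hW s hs t ht hst
    _ = ∫⁻ r in Ioo s t, h r := (setLIntegral_congr Ioo_ae_eq_Icc).symm
    _ ≤ ∫⁻ r in Ioo s t, κ r := setLIntegral_mono' measurableSet_Ioo fun r hr =>
        hκ r ⟨hs.1.trans hr.1.le, hr.2.le.trans ht.2⟩ (hne r hr)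
  let Z : Set ℝ := Icc a b ∩ W ⁻¹' {0}
  have hZ : IsCompact Z := isCompact_Icc.of_isClosed_subset
    ((continuousOn_of_abs_sub_le_lintegral hW hfin).preimage_isClosed_of_isClosed isClosed_Icc
      isClosed_singleton) inter_subset_left
  rcases Z.eq_empty_or_nonempty with hempty | hnonempty
  · refine (hpiece a ha b hb hab fun r hr hWr => ?_).trans (lintegral_mono_set Ioo_subset_Icc_self)
    exact notMem_empty r (hempty ▸ ⟨Ioo_subset_Icc_self hr, hWr⟩)
  obtain ⟨α, ⟨hαI, hWα⟩, hα⟩ := hZ.exists_isLeast hnonempty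
  obtain ⟨β, ⟨hβI, hWβ⟩, hβ⟩ := hZ.exists_isGreatest hnonempty
  have hαβ : α ≤ β := hα ⟨hβI, hWβ⟩
  have hleft : ENNReal.ofReal |W a| ≤ ∫⁻ r in Ioo a α, κ r := by
    simpa [show W α = 0 from hWα] using hpiece a ha α hαI hαI.1 fun r hr hWr =>
      hr.2.not_ge (hα ⟨⟨hr.1.le, hr.2.le.trans hαI.2⟩, hWr⟩)
  have hright : ENNReal.ofReal |W b| ≤ ∫⁻ r in Ioo β b, κ r := by
    simpa [show W β = 0 from hWβ] using hpiece β hβI b hb hβI.2 fun r hr hWr =>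
      hr.1.not_ge (hβ ⟨⟨hβI.1.trans hr.1.le, hr.2.le⟩, hWr⟩)
  calc ENNReal.ofReal |W a - W b| ≤ ENNReal.ofReal |W a| + ENNReal.ofReal |W b| :=
        (ENNReal.ofReal_le_ofReal (abs_sub _ _)).trans ENNReal.ofReal_add_le
    _ ≤ ∫⁻ r in Ioo a α ∪ Ioo β b, κ r := by
        rw [lintegral_union measurableSet_Ioo (disjoint_left.2 fun r hr hr' =>
          ((hr.2.trans_le hαβ).trans hr'.1).false)]
        exact add_le_add hleft hright
    _ ≤ ∫⁻ r in Icc a b, κ r := lintegral_mono_set (union_subset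
        (Ioo_subset_Icc_self.trans (Icc_subset_Icc_right hαI.2))
        (Ioo_subset_Icc_self.trans (Icc_subset_Icc_left hβI.1)))

end ControlledByIntegral

/-! ### Upper gradients -/

section UpperGradient

variable {P : Type*} [PseudoMetricSpace P]

theorem hasUnitSpeedOn_comp_add_right {γ : ℝ → P} {l a b : ℝ} (hγ : HasUnitSpeedOn γ (Icc 0 l))
    (ha : 0 ≤ a) (hb : b ≤ l) : HasUnitSpeedOn (fun t => γ (t + a)) (Icc 0 (b - a)) := by
  intro x hx y hy
  have himage : (fun t => t + a) '' (Icc 0 (b - a) ∩ Icc x y) = Icc 0 l ∩ Icc (x + a) (y + a) := by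
    rw [Icc_inter_Icc, Icc_inter_Icc, image_add_const_Icc, max_eq_right hx.1, min_eq_right hy.2,
      max_eq_right (by linarith [hx.1]), min_eq_right (by linarith [hy.2])]
  have hcomp := eVariationOn.comp_eq_of_monotoneOn γ (t := Icc 0 (b - a) ∩ Icc x y)
    (fun t : ℝ => t + a) (fun s _ t _ hst => by simpa using hst)
  have hspeed := hγ (x := x + a) ⟨by linarith [hx.1], by linarith [hx.2]⟩ (y := y + a)
    ⟨by linarith [hy.1], by linarith [hy.2]⟩
  rw [add_sub_add_right_eq_sub, ← himage, ← hcomp] at hspeed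
  exact hspeed

variable [MeasurableSpace P] {u v w : P → EReal} {g h : P → ℝ≥0∞}

theorem IsUpperGradient.abs_sub_le_subcurve (hu : IsUpperGradient u g) {γ : ℝ → P} {l a b : ℝ}
    (hγ : HasUnitSpeedOn γ (Icc 0 l)) (ha : 0 ≤ a) (hab : a < b) (hb : b ≤ l) :
    (u (γ a) - u (γ b)).abs ≤ ∫⁻ t in Icc a b, g (γ t) := by
  have hshift := hu.2 (fun t => γ (t + a)) (b - a) (sub_pos.2 hab)
    (hasUnitSpeedOn_comp_add_right hγ ha hb)
  have hpreimage : Icc 0 (b - a) = (fun t => t + a) ⁻¹' (Icc a b) := by simp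
  rwa [zero_add, sub_add_cancel, hpreimage,
    (measurePreserving_add_right volume a).setLIntegral_comp_preimage_emb
      (measurableEmbedding_addRight a) (fun t => g (γ t))] at hshift

theorem IsUpperGradient.of_abs_sub_le (hu : IsUpperGradient u g)
    (huv : ∀ x y, (v x - v y).abs ≤ (u x - u y).abs) : IsUpperGradient v g :=
  ⟨hu.1, fun γ l hl hγ => (huv _ _).trans (hu.2 γ l hl hγ)⟩

theorem IsUpperGradient.of_abs_sub_le_add (hu : IsUpperGradient u g) (hv : IsUpperGradient v h)
    (hw : ∀ x y, (w x - w y).abs ≤ (u x - u y).abs + (v x - v y).abs) :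
    IsUpperGradient w (fun x => g x + h x) :=
  ⟨hu.1.add hv.1, fun γ l hl hγ => (hw _ _).trans
    ((add_le_add (hu.2 γ l hl hγ) (hv.2 γ l hl hγ)).trans (le_lintegral_add _ _))⟩

theorem isUpperGradient_const_of_lipschitzWith {f : P → ℝ} {K : ℝ≥0} (hf : LipschitzWith K f) :
    IsUpperGradient (fun x => (f x : EReal)) (fun _ => K) := by
  refine ⟨measurable_const, fun γ l hl hγ => ?_⟩
  have hzero : (0 : ℝ) ∈ Icc 0 l := left_mem_Icc.2 hl.le
  have hend : l ∈ Icc 0 l := right_mem_Icc.2 hl.le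
  have hdist : edist (γ 0) (γ l) ≤ ENNReal.ofReal l := by
    refine (eVariationOn.edist_le γ hzero hend).trans_eq ?_
    simpa using hγ hzero hend
  rw [ereal_abs_coe_sub_coe, ← Real.dist_eq, ← edist_dist, setLIntegral_const, Real.volume_Icc,
    sub_zero]
  exact (hf _ _).trans (by gcongr)

theorem IsUpperGradient.exists_real_of_lintegral_ne_top (hw : IsUpperGradient w h) {γ : ℝ → P}
    {l : ℝ} (hl : 0 < l) (hγ : HasUnitSpeedOn γ (Icc 0 l))
    (hfin : ∫⁻ t in Icc 0 l, h (γ t) ≠ ∞) {t : ℝ} (ht : t ∈ Icc 0 l) :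
    ∃ x : ℝ, w (γ t) = x := by
  have hsub : ∀ a b, 0 ≤ a → a < b → b ≤ l → (w (γ a) - w (γ b)).abs < ∞ := fun a b ha hab hb =>
    (hw.abs_sub_le_subcurve hγ ha hab hb).trans_lt
      ((lintegral_mono_set (Icc_subset_Icc ha hb)).trans_lt hfin.lt_top)
  rcases ht.2.lt_or_eq with htl | rfl
  · obtain ⟨x, -, hx, -⟩ := exists_real_of_ereal_abs_sub_lt_top (hsub t l ht.1 htl le_rfl)
    exact ⟨x, hx⟩
  · obtain ⟨-, y, -, hy⟩ := exists_real_of_ereal_abs_sub_lt_top (hsub 0 t le_rfl hl le_rfl)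
    exact ⟨y, hy⟩

theorem IsUpperGradient.abs_sub_le_lintegral_indicator (hw : IsUpperGradient w h) {A : Set P}
    (hwA : ∀ x ∉ A, w x = 0) {γ : ℝ → P} {l : ℝ} (hl : 0 < l) (hγ : HasUnitSpeedOn γ (Icc 0 l))
    (hfin : ∫⁻ t in Icc 0 l, h (γ t) ≠ ∞) :
    (w (γ 0) - w (γ l)).abs ≤ ∫⁻ t in Icc 0 l, A.indicator h (γ t) := by
  let W : ℝ → ℝ := fun t => (w (γ t)).toReal
  have hW : ∀ t ∈ Icc 0 l, w (γ t) = W t := by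
    intro t ht
    obtain ⟨x, hx⟩ := hw.exists_real_of_lintegral_ne_top hl hγ hfin ht
    simp [W, hx]
  have hcontrol : ∀ s ∈ Icc 0 l, ∀ t ∈ Icc 0 l, s ≤ t →
      ENNReal.ofReal |W s - W t| ≤ ∫⁻ r in Icc s t, h (γ r) := by
    intro s hs t ht hst
    rcases hst.eq_or_lt with rfl | hst
    · simp
    · rw [← ereal_abs_coe_sub_coe, ← hW s hs, ← hW t ht]
      exact hw.abs_sub_le_subcurve hγ hs.1 hst ht.2
  rw [hW 0 (left_mem_Icc.2 hl.le), hW l (right_mem_Icc.2 hl.le), ereal_abs_coe_sub_coe]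
  refine abs_sub_le_lintegral_of_le_where_ne_zero hl.le hcontrol hfin fun t _ hne => ?_
  have hmem : γ t ∈ A := by
    by_contra hnot
    exact hne (by simp [W, hwA _ hnot])
  rw [indicator_of_mem hmem]

-- The term `η * g` forces `h` to be integrable along every curve that matters.
theorem IsUpperGradient.indicator_add_mul (hw : IsUpperGradient w h) (hg : Measurable g)
    {c η : ℝ≥0} (hη : η ≠ 0) (hle : ∀ x, h x ≤ c * (g x + 1)) {A : Set P} (hA : MeasurableSet A)
    (hwA : ∀ x ∉ A, w x = 0) : IsUpperGradient w (fun x => A.indicator h x + η * g x) := by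
  refine ⟨(hw.1.indicator hA).add (hg.const_mul _), fun γ l hl hγ => ?_⟩
  by_cases hfin : ∫⁻ t in Icc 0 l, (A.indicator h (γ t) + η * g (γ t)) = ∞
  · rw [hfin]
    exact le_top
  have hgfin : ∫⁻ t in Icc 0 l, g (γ t) ≠ ∞ := by
    intro hgtop
    have hle' := lintegral_mono (μ := volume.restrict (Icc 0 l)) fun t =>
      le_add_self (a := η * g (γ t)) (b := A.indicator h (γ t))
    rw [lintegral_const_mul' _ _ ENNReal.coe_ne_top, hgtop,
      ENNReal.mul_top (ENNReal.coe_ne_zero.2 hη)] at hle'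
    exact hfin (top_le_iff.1 hle')
  have hhfin : ∫⁻ t in Icc 0 l, h (γ t) ≠ ∞ := by
    refine ne_top_of_le_ne_top ?_ (lintegral_mono fun t => hle (γ t))
    rw [lintegral_const_mul' _ _ ENNReal.coe_ne_top, lintegral_add_right _ measurable_const]
    exact ENNReal.mul_ne_top ENNReal.coe_ne_top (ENNReal.add_ne_top.2 ⟨hgfin, by simp⟩)
  exact (hw.abs_sub_le_lintegral_indicator hwA hl hγ hhfin).trans
    (lintegral_mono fun t => le_self_add)

end UpperGradient

/-! ### Rearrangement-invariant spaces -/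

theorem setOf_lt_indicator_one {α : Type*} (E : Set α) (s : ℝ≥0∞) :
    {x | s < E.indicator 1 x} = if s < 1 then E else ∅ := by
  ext x
  by_cases hx : x ∈ E <;> by_cases hs : s < 1 <;> simp [hx, hs]

namespace RISpace

variable {α : Type*} [MeasurableSpace α] {μ : Measure α}

section IndicatorFunctions

variable (X : RISpace μ) {E F : Set α} {c : ℝ≥0} {f : α → ℝ≥0∞}

theorem indicator_one_eq_zero (hE : μ E = 0) : X (E.indicator 1) = 0 :=
  (X.eq_zero_iff _ (aemeasurable_one.indicator₀ (NullMeasurableSet.of_null hE))).2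
    (indicator_meas_zero hE)

theorem indicator_one_pos (hEm : NullMeasurableSet E μ) (hE : μ E ≠ 0) :
    0 < X (E.indicator 1) := by
  refine pos_iff_ne_zero.2 fun hX => hE ?_
  have hsupp : (Function.support fun _ : α => (1 : ℝ≥0∞)) = univ := by ext; simp
  have hae := (X.eq_zero_iff _ (aemeasurable_one.indicator₀ hEm)).1 hX
  rwa [indicator_ae_eq_zero, hsupp, inter_univ] at hae

theorem coe_mul_indicator_one_le (hE : NullMeasurableSet E μ) (hf : AEMeasurable f μ)
    (hle : ∀ x ∈ E, c ≤ f x) : c * X (E.indicator 1) ≤ X f := by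
  have hm : AEMeasurable (E.indicator (1 : α → ℝ≥0∞)) μ := aemeasurable_one.indicator₀ hE
  rw [← X.smul c _ hm]
  refine X.mono _ _ (hm.const_mul _) hf (Eventually.of_forall fun x => ?_)
  by_cases hx : x ∈ E <;> simp [hx, hle]

theorem le_coe_mul_indicator_one (hE : NullMeasurableSet E μ) (hf : AEMeasurable f μ)
    (hle : ∀ x ∈ E, f x ≤ c) (hzero : ∀ x ∉ E, f x = 0) : X f ≤ c * X (E.indicator 1) := by
  have hm : AEMeasurable (E.indicator (1 : α → ℝ≥0∞)) μ := aemeasurable_one.indicator₀ hE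
  rw [← X.smul c _ hm]
  refine X.mono _ _ hf (hm.const_mul _) (Eventually.of_forall fun x => ?_)
  by_cases hx : x ∈ E <;> simp [hx, hle, hzero]

theorem indicator_one_congr (hE : NullMeasurableSet E μ) (hF : NullMeasurableSet F μ)
    (hEF : μ E = μ F) : X (E.indicator 1) = X (F.indicator 1) := by
  refine X.rearrangement_invariant _ _ (aemeasurable_one.indicator₀ hE)
    (aemeasurable_one.indicator₀ hF) fun t => ?_
  rw [setOf_lt_indicator_one, setOf_lt_indicator_one]
  split_ifs <;> simp [hEF]

end IndicatorFunctions

theorem ae_lt_top (X : RISpace μ) {f : α → ℝ≥0∞} (hf : AEMeasurable f μ) (hX : X f < ∞) :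
    ∀ᵐ x ∂μ, f x < ∞ := by
  have hE : NullMeasurableSet {x | f x = ∞} μ := hf.nullMeasurable (measurableSet_singleton _)
  have hnat (n : ℕ) : (n : ℝ≥0∞) * X ({x | f x = ∞}.indicator 1) ≤ X f := by
    simpa using X.coe_mul_indicator_one_le hE (c := n) hf fun x (hx : f x = ∞) => by simp [hx]
  have hzero : μ {x | f x = ∞} = 0 := by
    by_contra hne
    obtain ⟨n, hn⟩ := ENNReal.exists_nat_mul_gt (X.indicator_one_pos hE hne).ne' hX.ne
    exact (hnat n).not_gt hn
  rw [ae_iff]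
  simpa using hzero

section AbsolutelyContinuousNorm

variable {X : RISpace μ} {f : α → ℝ≥0∞}

/- If `μ E = ∞`, then removing a set of finite measure from `E` leaves the norm of `χ_E` unchanged,
so the norm cannot be absolutely continuous at `χ_E`. -/
theorem HasACNorm.measure_lt_top_of_indicator_one_lt_top [SigmaFinite μ] (hAC : X.HasACNorm)
    {E : Set α} (hE : NullMeasurableSet E μ) (hX : X (E.indicator 1) < ∞) : μ E < ∞ := by
  by_contra hnot
  have htop : μ E = ∞ := not_lt_top_iff.1 hnot
  have hSm (n : ℕ) : NullMeasurableSet (spanningSets μ n)ᶜ μ :=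
    (measurableSet_spanningSets μ n).compl.nullMeasurableSet
  have hconst (n : ℕ) :
      X ((spanningSets μ n)ᶜ.indicator (E.indicator 1)) = X (E.indicator 1) := by
    rw [indicator_indicator]
    refine X.indicator_one_congr ((hSm n).inter hE) hE ?_
    rw [htop, inter_comm, ← sdiff_eq]
    exact measure_sdiff_eq_top htop (measure_spanningSets_lt_top μ n).ne
  have hlim := hAC _ (aemeasurable_one.indicator₀ hE) hX (fun n => (spanningSets μ n)ᶜ) hSm
    (fun m n hmn => compl_subset_compl.2 (monotone_spanningSets μ hmn)) (by
      rw [← compl_iUnion, iUnion_spanningSets, compl_univ, measure_empty])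
  exact (X.indicator_one_pos hE (by simp [htop])).ne
    (tendsto_nhds_unique (hlim.congr hconst) tendsto_const_nhds)

theorem HasACNorm.measure_superlevel_lt_top [SigmaFinite μ] (hAC : X.HasACNorm)
    (hf : AEMeasurable f μ) (hX : X f < ∞) {c : ℝ≥0} (hc : c ≠ 0) :
    μ {x | (c : ℝ≥0∞) < f x} < ∞ := by
  have hE : NullMeasurableSet {x | (c : ℝ≥0∞) < f x} μ := hf.nullMeasurable measurableSet_Ioi
  refine hAC.measure_lt_top_of_indicator_one_lt_top hE (ENNReal.lt_top_of_mul_ne_top_right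
    (a := c) ?_ (ENNReal.coe_ne_zero.2 hc))
  exact ((X.coe_mul_indicator_one_le hE hf fun x (hx : (c : ℝ≥0∞) < f x) => hx.le).trans_lt hX).ne

theorem HasACNorm.tendsto_indicator_of_summable_measure (hAC : X.HasACNorm)
    (hf : AEMeasurable f μ) (hX : X f < ∞) {A : ℕ → Set α} (hA : ∀ n, NullMeasurableSet (A n) μ)
    (hsum : ∑' n, μ (A n) ≠ ∞) : Tendsto (fun n => X ((A n).indicator f)) atTop (𝓝 0) := by
  set E : ℕ → Set α := fun n => ⋃ m, ⋃ (_ : n ≤ m), A m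
  have hEm (n : ℕ) : NullMeasurableSet (E n) μ :=
    .iUnion fun m => .iUnion fun _ => hA m
  have hanti : Antitone E := fun m n hmn =>
    iUnion_mono fun i => iUnion_mono' fun hi => ⟨hmn.trans hi, subset_rfl⟩
  have hzero : μ (⋂ n, E n) = 0 := by
    rw [← measure_limsup_atTop_eq_zero hsum, limsup_eq_iInf_iSup_of_nat]
    rfl
  refine tendsto_of_tendsto_of_tendsto_of_le_of_le tendsto_const_nhds
    (hAC f hf hX E hEm hanti hzero) (fun _ => zero_le) fun n => ?_
  refine X.mono _ _ (hf.indicator₀ (hA n)) (hf.indicator₀ (hEm n)) (Eventually.of_forall ?_)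
  exact indicator_le_indicator_of_subset (subset_iUnion₂_of_subset n le_rfl subset_rfl)
    fun _ => zero_le

theorem HasACNorm.exists_indicator_lt (hAC : X.HasACNorm) (hf : AEMeasurable f μ) (hX : X f < ∞)
    {ε : ℝ≥0∞} (hε : 0 < ε) :
    ∃ δ > 0, ∀ A, NullMeasurableSet A μ → μ A < δ → X (A.indicator f) < ε := by
  by_contra! hcon
  choose A hAm hA hAX using fun n : ℕ => hcon (2⁻¹ ^ n) (ENNReal.pow_pos (by simp) n)
  have hsum : ∑' n, μ (A n) ≠ ∞ := by
    refine ne_top_of_le_ne_top ENNReal.ofNat_ne_top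
      (b := 2) ((ENNReal.tsum_le_tsum fun n => (hA n).le).trans_eq ?_)
    rw [ENNReal.tsum_geometric, ENNReal.one_sub_inv_two, inv_inv]
  obtain ⟨n, hn⟩ := ((hAC.tendsto_indicator_of_summable_measure hf hX hAm hsum).eventually
    (gt_mem_nhds hε)).exists
  exact (hAX n).not_gt hn

theorem antitone_superlevel {α : Type*} (f : α → ℝ≥0∞) :
    Antitone fun n : ℕ => {x | (n : ℝ≥0∞) < f x} :=
  fun m n hmn x (hx : (n : ℝ≥0∞) < f x) => (Nat.cast_le.2 hmn : (m : ℝ≥0∞) ≤ n).trans_lt hx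

theorem measure_iInter_superlevel (hf : AEMeasurable f μ) (hX : X f < ∞) :
    μ (⋂ n : ℕ, {x | (n : ℝ≥0∞) < f x}) = 0 := by
  refine measure_mono_null (fun x hx => ?_) (ae_iff.1 (X.ae_lt_top hf hX))
  rw [mem_iInter] at hx
  by_contra hlt
  obtain ⟨n, hn⟩ := ENNReal.exists_nat_gt (not_not.1 hlt).ne
  exact (hx n).not_gt hn

theorem HasACNorm.tendsto_indicator_superlevel (hAC : X.HasACNorm) (hf : AEMeasurable f μ)
    (hX : X f < ∞) :
    Tendsto (fun n : ℕ => X ({x | (n : ℝ≥0∞) < f x}.indicator f)) atTop (𝓝 0) :=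
  hAC f hf hX _ (fun _ => hf.nullMeasurable measurableSet_Ioi) (antitone_superlevel f)
    (measure_iInter_superlevel hf hX)

theorem HasACNorm.tendsto_measure_superlevel [SigmaFinite μ] (hAC : X.HasACNorm)
    (hf : AEMeasurable f μ) (hX : X f < ∞) :
    Tendsto (fun n : ℕ => μ {x | (n : ℝ≥0∞) < f x}) atTop (𝓝 0) := by
  rw [← measure_iInter_superlevel hf hX]
  exact tendsto_measure_iInter_atTop (fun _ => hf.nullMeasurable measurableSet_Ioi)
    (antitone_superlevel f) ⟨1, by simpa using (hAC.measure_superlevel_lt_top hf hX one_ne_zero).ne⟩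

end AbsolutelyContinuousNorm

end RISpace

/-! ### The Newtonian norm -/

section NewtonianNorm

variable {P : Type*} [PseudoMetricSpace P] [MeasurableSpace P] {μ : Measure P} {X : RISpace μ}
  {u v w : P → EReal} {g h : P → ℝ≥0∞}

theorem newtonianNorm_le (hu : IsUpperGradient u g) :
    newtonianNorm X u ≤ X (fun x => (u x).abs) + X g :=
  add_le_add le_rfl (iInf₂_le g hu)

theorem exists_isUpperGradient_of_newtonianNorm_lt_top (hu : newtonianNorm X u < ∞) :
    ∃ g, IsUpperGradient u g ∧ X g < ∞ := by
  simpa only [iInf_lt_iff, exists_prop] using (ENNReal.add_lt_top.1 hu).2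

theorem newtonianNorm_le_newtonianNorm (hu : AEMeasurable u μ) (hv : AEMeasurable v μ)
    (habs : ∀ x, (v x).abs ≤ (u x).abs) (hsub : ∀ x y, (v x - v y).abs ≤ (u x - u y).abs) :
    newtonianNorm X v ≤ newtonianNorm X u :=
  add_le_add (X.mono _ _ (measurable_ereal_abs.comp_aemeasurable hv)
      (measurable_ereal_abs.comp_aemeasurable hu) (Eventually.of_forall habs))
    (le_iInf₂ fun g hg => iInf₂_le g (hg.of_abs_sub_le hsub))

theorem newtonianNorm_le_add (hu : AEMeasurable u μ) (hv : AEMeasurable v μ)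
    (hw : AEMeasurable w μ) (habs : ∀ x, (w x).abs ≤ (u x).abs + (v x).abs)
    (hsub : ∀ x y, (w x - w y).abs ≤ (u x - u y).abs + (v x - v y).abs) :
    newtonianNorm X w ≤ newtonianNorm X u + newtonianNorm X v := by
  have hu' := measurable_ereal_abs.comp_aemeasurable hu
  have hv' := measurable_ereal_abs.comp_aemeasurable hv
  have hnorm : X (fun x => (w x).abs) ≤ X (fun x => (u x).abs) + X (fun x => (v x).abs) :=
    (X.mono _ _ (measurable_ereal_abs.comp_aemeasurable hw) (hu'.add hv')
      (Eventually.of_forall habs)).trans (X.add_le _ _ hu' hv')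
  have hgrad : ⨅ (g) (_ : IsUpperGradient w g), X g ≤
      (⨅ (g) (_ : IsUpperGradient u g), X g) + ⨅ (g) (_ : IsUpperGradient v g), X g :=
    ENNReal.le_iInf₂_add_iInf₂ fun g hg h hh =>
      (iInf₂_le _ (hg.of_abs_sub_le_add hh hsub)).trans
        (X.add_le _ _ hg.1.aemeasurable hh.1.aemeasurable)
  exact (add_le_add hnorm hgrad).trans_eq (add_add_add_comm _ _ _ _)

theorem newtonianNorm_le_add_indicator (hw : IsUpperGradient w h) (hg : Measurable g)
    (hgX : X g < ∞) {c : ℝ≥0} (hle : ∀ x, h x ≤ c * (g x + 1)) {A : Set P} (hA : MeasurableSet A)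
    (hwA : ∀ x ∉ A, w x = 0) :
    newtonianNorm X w ≤ X (fun x => (w x).abs) + X (A.indicator h) := by
  refine ENNReal.le_of_forall_pos_le_add fun ε hε _ => ?_
  obtain ⟨η, hη, hηX⟩ := ENNReal.exists_nnreal_pos_mul_lt hgX.ne (ENNReal.coe_ne_zero.2 hε.ne')
  calc newtonianNorm X w
      ≤ X (fun x => (w x).abs) + X (fun x => A.indicator h x + η * g x) :=
        newtonianNorm_le (hw.indicator_add_mul hg hη.ne' hle hA hwA)
    _ ≤ X (fun x => (w x).abs) + (X (A.indicator h) + η * X g) := by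
        rw [← X.smul η g hg.aemeasurable]
        gcongr
        exact X.add_le _ _ (hw.1.indicator hA).aemeasurable (hg.aemeasurable.const_mul _)
    _ ≤ X (fun x => (w x).abs) + X (A.indicator h) + ε := by
        rw [← add_assoc]
        gcongr

theorem exists_newtonianNorm_sub_truncateEReal_lt [SigmaFinite μ] (hAC : X.HasACNorm)
    (hum : AEMeasurable u μ) (hu : newtonianNorm X u < ∞) {ε : ℝ≥0∞} (hε : 0 < ε) :
    ∃ k : ℝ≥0, newtonianNorm X (fun x => u x - truncateEReal k (u x)) < ε := by
  obtain ⟨g, hg, hgX⟩ := exists_isUpperGradient_of_newtonianNorm_lt_top hu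
  have huX : X (fun x => (u x).abs) < ∞ := (ENNReal.add_lt_top.1 hu).1
  have habs := measurable_ereal_abs.comp_aemeasurable hum
  have hε2 : 0 < ε / 2 := ENNReal.half_pos hε.ne'
  obtain ⟨δ₁, hδ₁, hδ₁X⟩ := hAC.exists_indicator_lt habs huX hε2
  obtain ⟨δ₂, hδ₂, hδ₂X⟩ := hAC.exists_indicator_lt hg.1.aemeasurable hgX hε2
  obtain ⟨n, hn⟩ := ((hAC.tendsto_measure_superlevel habs huX).eventually
    (gt_mem_nhds (lt_min hδ₁ hδ₂))).exists
  set A := toMeasurable μ {x | (n : ℝ≥0∞) < (u x).abs}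
  have hA : MeasurableSet A := measurableSet_toMeasurable _ _
  have hμA : μ A < min δ₁ δ₂ := (measure_toMeasurable _).trans_lt hn
  have hzero : ∀ x ∉ A, u x - truncateEReal n (u x) = 0 := fun x hx =>
    sub_truncateEReal_eq_zero _ (by simpa using notMem_subset (subset_toMeasurable _ _) hx)
  have hwm : AEMeasurable (fun x => u x - truncateEReal n (u x)) μ :=
    (measurable_id.sub (measurable_truncateEReal n).coe_real_ereal).comp_aemeasurable hum
  refine ⟨n, ?_⟩
  calc newtonianNorm X (fun x => u x - truncateEReal n (u x))
      ≤ X (fun x => (u x - truncateEReal n (u x)).abs) + X (A.indicator g) :=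
        newtonianNorm_le_add_indicator (c := 1)
          (hg.of_abs_sub_le fun x y => ereal_abs_sub_truncateEReal_sub_le _ _ _) hg.1 hgX
          (by simp) hA hzero
    _ ≤ X (A.indicator fun x => (u x).abs) + X (A.indicator g) := by
        gcongr
        refine X.mono _ _ (measurable_ereal_abs.comp_aemeasurable hwm)
          (habs.indicator₀ hA.nullMeasurableSet) (Eventually.of_forall fun x => ?_)
        by_cases hx : x ∈ A
        · simpa only [indicator_of_mem hx] using ereal_abs_sub_truncateEReal_le _ _
        · simp only [hzero x hx, EReal.abs_zero, zero_le]
    _ < ε / 2 + ε / 2 :=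
        ENNReal.add_lt_add (hδ₁X A hA.nullMeasurableSet (hμA.trans_le (min_le_left _ _)))
          (hδ₂X A hA.nullMeasurableSet (hμA.trans_le (min_le_right _ _)))
    _ = ε := ENNReal.add_halves ε

end NewtonianNorm

/-! ### Control of `L^p` means by the norm -/

namespace RISpace

variable {α : Type*} [MeasurableSpace α] {μ : Measure α} {X : RISpace μ} {p : ℝ} {c : ℝ≥0}
  {δ : ℝ≥0∞}

/-- On a set of measure less than `δ`, the `L^p` mean of a function supported there is at most `c`
times its norm divided by the norm of the indicator function of the set. The inequality is stated
without divisions. -/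
def ControlsLpMeanWith (X : RISpace μ) (p : ℝ) (c : ℝ≥0) (δ : ℝ≥0∞) : Prop :=
  ∀ (E : Set α) (f : α → ℝ≥0∞), NullMeasurableSet E μ → 0 < μ E → μ E < δ → AEMeasurable f μ →
    (∀ x ∉ E, f x = 0) → X f < ∞ →
    X (E.indicator 1) * (∫⁻ x, f x ^ p ∂μ) ^ (1 / p) ≤ c * μ E ^ (1 / p) * X f

/-- On sets of small measure, `L^p` means are controlled by the norm of `X` relative to the norm of
the indicator function. This is the common consequence of the conditions (1)–(9) of the theorem,
and the only one from which density of Lipschitz functions is derived. -/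
def ControlsLpMean (X : RISpace μ) (p : ℝ) : Prop :=
  ∃ (c : ℝ≥0) (δ : ℝ≥0∞), 0 < δ ∧ X.ControlsLpMeanWith p c δ

theorem ControlsLpMeanWith.lintegral_rpow_lt_top (hX : X.ControlsLpMeanWith p c δ) (hp : 0 < p)
    {E : Set α} {f : α → ℝ≥0∞} (hE : NullMeasurableSet E μ) (hEδ : μ E < δ)
    (hf : AEMeasurable f μ) (hfE : ∀ x ∉ E, f x = 0) (hfX : X f < ∞) :
    ∫⁻ x, f x ^ p ∂μ < ∞ := by
  rcases eq_zero_or_pos (μ E) with hzero | hpos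
  · have hae : (fun x => f x ^ p) =ᵐ[μ] 0 := by
      filter_upwards [measure_eq_zero_iff_ae_notMem.1 hzero] with x hx
      simp [hfE x hx, hp]
    rw [lintegral_congr_ae hae]
    simp
  · have hfin : c * μ E ^ (1 / p) * X f ≠ ∞ :=
      ENNReal.mul_ne_top (ENNReal.mul_ne_top ENNReal.coe_ne_top
        (ENNReal.rpow_ne_top_of_nonneg (by positivity) (ne_top_of_lt hEδ))) hfX.ne
    have hroot := ENNReal.lt_top_of_mul_ne_top_right
      (ne_top_of_le_ne_top hfin (hX E f hE hpos hEδ hf hfE hfX))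
      (X.indicator_one_pos hE hpos.ne').ne'
    exact (ENNReal.rpow_lt_top_iff_of_pos (by positivity)).1 hroot

end RISpace

/-! ### The exceptional set -/

section ExceptionalSet

/-- The part `g χ_{g > a}` of `g` above the level `a`. -/
def partAbove {α : Type*} (g : α → ℝ≥0∞) (a : ℝ≥0∞) : α → ℝ≥0∞ := {x | a < g x}.indicator g

theorem measurable_partAbove {α : Type*} [MeasurableSpace α] {g : α → ℝ≥0∞} (hg : Measurable g)
    (a : ℝ≥0∞) : Measurable (partAbove g a) :=
  hg.indicator (hg measurableSet_Ioi)

theorem antitone_partAbove {α : Type*} (g : α → ℝ≥0∞) : Antitone (partAbove g) :=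
  fun _ _ hab => indicator_le_indicator_of_subset
    (fun _ hx => lt_of_le_of_lt hab hx) fun _ => zero_le

theorem RISpace.partAbove_lt_top {α : Type*} [MeasurableSpace α] {μ : Measure α} {X : RISpace μ}
    {g : α → ℝ≥0∞} (hg : Measurable g) (hgX : X g < ∞) (a : ℝ≥0∞) : X (partAbove g a) < ∞ :=
  (X.mono _ _ (measurable_partAbove hg a).aemeasurable hg.aemeasurable
    (Eventually.of_forall (indicator_le_self _ _))).trans_lt hgX

variable {P : Type*} [PseudoMetricSpace P] [MeasurableSpace P] {μ : Measure P} {X : RISpace μ}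
  {C c : ℝ≥0} {p : ℝ} {g : P → ℝ≥0∞}

/-- The set where `g > a` or where the maximal function of `(g χ_{g > a})^p` exceeds `a^p`, enlarged
to a measurable set of the same measure. Only the part of `g` above `a` enters, because its norm
tends to `0` as `a → ∞`. -/
def exceptionalSet (μ : Measure P) (p : ℝ) (g : P → ℝ≥0∞) (a : ℝ≥0∞) : Set P :=
  toMeasurable μ ({x | a < g x} ∪ maximalSuperlevel μ (fun y => partAbove g a y ^ p) (a ^ p))

theorem measurableSet_exceptionalSet {a : ℝ≥0∞} : MeasurableSet (exceptionalSet μ p g a) :=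
  measurableSet_toMeasurable _ _

theorem rpow_mul_measure_exceptionalSet_le [OpensMeasurableSpace P] (hball : BallsFinitePos μ)
    (hC : IsDoublingWith μ C) (hp : 0 ≤ p) (hg : Measurable g) (a : ℝ≥0∞) :
    a ^ p * μ (exceptionalSet μ p g a) ≤ (1 + C ^ 3) * ∫⁻ x, partAbove g a x ^ p ∂μ := by
  have hcheb : a ^ p * μ {x | a < g x} ≤ ∫⁻ x, partAbove g a x ^ p ∂μ := by
    refine (mul_le_mul_right (measure_mono fun x (hx : a < g x) => ?_) _).trans
      (mul_meas_ge_le_lintegral ((measurable_partAbove hg a).pow_const p) (a ^ p))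
    have hpart : partAbove g a x = g x := indicator_of_mem (s := {x | a < g x}) hx _
    simpa only [mem_ofPred_eq, hpart] using ENNReal.rpow_le_rpow hx.le hp
  rw [exceptionalSet, measure_toMeasurable, add_mul, one_mul]
  refine (mul_le_mul_right (measure_union_le _ _) _).trans ?_
  rw [mul_add]
  exact add_le_add hcheb (hC.mul_measure_maximalSuperlevel_le hball _ _)

theorem lintegral_ball_rpow_le_of_notMem_exceptionalSet (hp : 1 ≤ p) {a : ℝ≥0∞} {x : P}
    (hx : x ∉ exceptionalSet μ p g a) {r : ℝ} (hr : 0 < r) :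
    ∫⁻ y in ball x r, g y ^ p ∂μ ≤ (2 * a) ^ p * μ (ball x r) := by
  have hp0 : 0 ≤ p := zero_le_one.trans hp
  have hmax : ∫⁻ y in ball x r, partAbove g a y ^ p ∂μ ≤ a ^ p * μ (ball x r) :=
    not_lt.1 fun hlt => hx (subset_toMeasurable _ _ (Or.inr ⟨r, hr, hlt⟩))
  have hsplit (y : P) : g y ^ p ≤ partAbove g a y ^ p + a ^ p := by
    by_cases hy : a < g y
    · rw [partAbove, indicator_of_mem (s := {x | a < g x}) hy]
      exact le_self_add
    · exact (ENNReal.rpow_le_rpow (not_lt.1 hy) hp0).trans le_add_self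
  have htwo : (2 : ℝ≥0∞) ≤ 2 ^ p := by
    simpa using ENNReal.rpow_le_rpow_of_exponent_le (x := 2) (by norm_num) hp
  calc ∫⁻ y in ball x r, g y ^ p ∂μ
      ≤ ∫⁻ y in ball x r, (partAbove g a y ^ p + a ^ p) ∂μ := lintegral_mono hsplit
    _ = ∫⁻ y in ball x r, partAbove g a y ^ p ∂μ + a ^ p * μ (ball x r) := by
        rw [lintegral_add_right _ measurable_const, setLIntegral_const]
    _ ≤ a ^ p * μ (ball x r) + a ^ p * μ (ball x r) := by gcongr
    _ = 2 * a ^ p * μ (ball x r) := by ring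
    _ ≤ (2 * a) ^ p * μ (ball x r) := by
        rw [ENNReal.mul_rpow_of_nonneg _ _ hp0]
        gcongr

theorem tendsto_measure_exceptionalSet [OpensMeasurableSpace P] (hball : BallsFinitePos μ)
    (hC : IsDoublingWith μ C) (hp : 0 < p) (hg : Measurable g) {n₀ : ℕ}
    (hfin : ∫⁻ x, partAbove g n₀ x ^ p ∂μ ≠ ∞) :
    Tendsto (fun n : ℕ => μ (exceptionalSet μ p g n)) atTop (𝓝 0) := by
  set M := (1 + (C : ℝ≥0∞) ^ 3) * ∫⁻ x, partAbove g n₀ x ^ p ∂μ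
  have hM : M ≠ ∞ := ENNReal.mul_ne_top (by finiteness) hfin
  have hpow : Tendsto (fun n : ℕ => (n : ℝ≥0∞) ^ p) atTop (𝓝 ∞) := by
    have hcont := (ENNReal.continuous_rpow_const (y := p)).tendsto ∞
    rw [ENNReal.top_rpow_of_pos hp] at hcont
    exact hcont.comp ENNReal.tendsto_nat_nhds_top
  have hlim : Tendsto (fun n : ℕ => M / (n : ℝ≥0∞) ^ p) atTop (𝓝 0) := by
    simpa only [ENNReal.div_top] using ENNReal.Tendsto.const_div hpow (Or.inr hM)
  refine tendsto_of_tendsto_of_tendsto_of_le_of_le' tendsto_const_nhds hlim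
    (Eventually.of_forall fun _ => zero_le) ?_
  filter_upwards [eventually_ge_atTop n₀, eventually_ge_atTop 1] with n hn hn1
  have hn0 : (n : ℝ≥0∞) ^ p ≠ 0 := by
    rw [Ne, ENNReal.rpow_eq_zero_iff_of_pos hp]
    positivity
  rw [ENNReal.le_div_iff_mul_le (Or.inl hn0)
    (Or.inl (ENNReal.rpow_ne_top_of_nonneg hp.le (ENNReal.natCast_ne_top n))), mul_comm]
  refine (rpow_mul_measure_exceptionalSet_le hball hC hp.le hg n).trans ?_
  refine mul_le_mul_right (lintegral_mono fun x => ENNReal.rpow_le_rpow ?_ hp.le) _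
  exact antitone_partAbove g (Nat.cast_le.2 hn) x

theorem RISpace.ControlsLpMeanWith.mul_indicator_exceptionalSet_le [OpensMeasurableSpace P]
    {δ : ℝ≥0∞} (hX : X.ControlsLpMeanWith p c δ) (hball : BallsFinitePos μ)
    (hC : IsDoublingWith μ C) (hp : 0 < p) (hg : Measurable g) (hgX : X g < ∞) {a : ℝ≥0∞}
    (hδ : μ (exceptionalSet μ p g a) < δ) :
    a * X ((exceptionalSet μ p g a).indicator 1) ≤
      c * (1 + C ^ 3) ^ (1 / p) * X (partAbove g a) := by
  set A := exceptionalSet μ p g a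
  set I := ∫⁻ x, partAbove g a x ^ p ∂μ
  have hA : NullMeasurableSet A μ := measurableSet_exceptionalSet.nullMeasurableSet
  have hfm := (measurable_partAbove hg a).aemeasurable (μ := μ)
  have hfX : X (partAbove g a) < ∞ := RISpace.partAbove_lt_top hg hgX a
  have hfA : ∀ x ∉ A, partAbove g a x = 0 := fun x hx =>
    indicator_of_notMem (fun h => hx (subset_toMeasurable _ _ (Or.inl h))) _
  rcases eq_or_ne (μ A) 0 with hA0 | hA0
  · simp [X.indicator_one_eq_zero hA0]
  rcases eq_or_ne a 0 with rfl | ha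
  · simp
  have hIA : a ^ p * μ A ≤ (1 + C ^ 3) * I := rpow_mul_measure_exceptionalSet_le hball hC hp.le hg a
  have hI0 : I ≠ 0 := by
    intro hzero
    rw [hzero, mul_zero, nonpos_iff_eq_zero, mul_eq_zero, ENNReal.rpow_eq_zero_iff_of_pos hp] at hIA
    exact hIA.elim ha hA0
  have hItop : I ≠ ∞ := (hX.lintegral_rpow_lt_top hp hA hδ hfm hfA hfX).ne
  have hroot : a * μ A ^ (1 / p) ≤ (1 + C ^ 3) ^ (1 / p) * I ^ (1 / p) := by
    have hle := ENNReal.rpow_le_rpow hIA (one_div_nonneg.2 hp.le)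
    rwa [ENNReal.mul_rpow_of_nonneg _ _ (by positivity),
      ENNReal.mul_rpow_of_nonneg _ _ (by positivity), ← ENNReal.rpow_mul,
      mul_one_div_cancel hp.ne', ENNReal.rpow_one] at hle
  have hR0 : I ^ (1 / p) ≠ 0 := by simp [hI0, hItop]
  have hRtop : I ^ (1 / p) ≠ ∞ := ENNReal.rpow_ne_top_of_nonneg (by positivity) hItop
  rw [← ENNReal.mul_le_mul_iff_left hR0 hRtop]
  calc a * X (A.indicator 1) * I ^ (1 / p) = a * (X (A.indicator 1) * I ^ (1 / p)) := mul_assoc ..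
    _ ≤ a * (c * μ A ^ (1 / p) * X (partAbove g a)) := by
        exact mul_le_mul_right (hX A _ hA (pos_iff_ne_zero.2 hA0) hδ hfm hfA hfX) _
    _ = c * (a * μ A ^ (1 / p)) * X (partAbove g a) := by ring
    _ ≤ c * ((1 + C ^ 3) ^ (1 / p) * I ^ (1 / p)) * X (partAbove g a) := by gcongr
    _ = _ := by ring

theorem RISpace.ControlsLpMean.exists_exceptionalSet_small [OpensMeasurableSpace P]
    (hX : X.ControlsLpMean p) (hball : BallsFinitePos μ) (hC : IsDoublingWith μ C) (hp : 0 < p)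
    (hAC : X.HasACNorm) (hg : Measurable g) (hgX : X g < ∞) {ε δ : ℝ≥0∞} (hε : 0 < ε)
    (hδ : 0 < δ) :
    ∃ a : ℝ≥0, 1 ≤ a ∧ μ (exceptionalSet μ p g a) < δ ∧
      a * X ((exceptionalSet μ p g a).indicator 1) < ε := by
  have := hball.sigmaFinite
  obtain ⟨c, δ', hδ', hX⟩ := hX
  obtain ⟨n₀, hn₀⟩ := ((hAC.tendsto_measure_superlevel hg.aemeasurable hgX).eventually
    (gt_mem_nhds hδ')).exists
  have hfin : ∫⁻ x, partAbove g n₀ x ^ p ∂μ ≠ ∞ :=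
    (hX.lintegral_rpow_lt_top hp (hg measurableSet_Ioi).nullMeasurableSet hn₀
      (measurable_partAbove hg _).aemeasurable (fun x hx => indicator_of_notMem hx _)
      (RISpace.partAbove_lt_top hg hgX _)).ne
  have hnorm : Tendsto (fun n : ℕ => c * (1 + (C : ℝ≥0∞) ^ 3) ^ (1 / p) * X (partAbove g n))
      atTop (𝓝 0) := by
    have hconst : c * (1 + (C : ℝ≥0∞) ^ 3) ^ (1 / p) ≠ ∞ := ENNReal.mul_ne_top ENNReal.coe_ne_top
      (ENNReal.rpow_ne_top_of_nonneg (by positivity) (by finiteness))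
    simpa only [mul_zero, partAbove] using ENNReal.Tendsto.const_mul
      (hAC.tendsto_indicator_superlevel hg.aemeasurable hgX) (Or.inr hconst)
  obtain ⟨n, hnδ, hnε, hn⟩ := (((tendsto_measure_exceptionalSet hball hC hp hg hfin).eventually
    (gt_mem_nhds (lt_min hδ hδ'))).and ((hnorm.eventually (gt_mem_nhds hε)).and
    (eventually_ge_atTop 1))).exists
  refine ⟨n, by exact_mod_cast hn, hnδ.trans_le (min_le_left _ _), ?_⟩
  exact (hX.mul_indicator_exceptionalSet_le hball hC hp hg hgX
    (hnδ.trans_le (min_le_right _ _))).trans_lt hnε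

end ExceptionalSet

/-! ### Lipschitz approximation -/

section LipschitzApproximation

variable {P : Type*} [PseudoMetricSpace P] [MeasurableSpace P] {μ : Measure P} {X : RISpace μ}
  {C : ℝ≥0} {p : ℝ}

theorem IsPoincareSpace.exists_hasLinearOscillationAt (hPI : IsPoincareSpace μ p)
    (hball : BallsFinitePos μ) (hp : 0 < p) :
    ∃ c : ℝ≥0, ∀ (u : P → ℝ) (g : P → ℝ≥0∞) (x : P) (b : ℝ≥0), IntegrableOnBalls u μ →
      IsUpperGradient (fun y => (u y : EReal)) g →
      (∀ r > 0, ∫⁻ y in ball x r, g y ^ p ∂μ ≤ b ^ p * μ (ball x r)) →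
      HasLinearOscillationAt μ u (c * b) x := by
  obtain ⟨c, l, -, hl, hPI⟩ := hPI
  refine ⟨2 * c, fun u g x b hu hg hx r hr => ?_⟩
  have hlr : 0 < l * r := by positivity
  have hgrad : (⨍⁻ y in ball x (l * r), g y ^ p ∂μ) ^ (1 / p) ≤ b := by
    rw [one_div, ENNReal.rpow_inv_le_iff hp, setLAverage_eq,
      ENNReal.div_le_iff (hball x _ hlr).1.ne' (hball x _ hlr).2.ne]
    exact hx _ hlr
  have hosc : ⨍⁻ y in ball x r, ‖u y - ⨍ z in ball x r, u z ∂μ‖ₑ ∂μ ≤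
      ENNReal.ofReal (2 * c * b * r) :=
    calc _ ≤ c * ENNReal.ofReal (2 * r) * b := by
          refine (hPI x r hr u hu g hg).trans ?_
          gcongr
          exact diam_ball hr.le
      _ = _ := by
          rw [← ENNReal.ofReal_coe_nnreal, ← ENNReal.ofReal_coe_nnreal (p := b),
            ← ENNReal.ofReal_mul (by positivity), ← ENNReal.ofReal_mul (by positivity)]
          ring_nf
  have hm : AEStronglyMeasurable (fun y => u y - ⨍ z in ball x r, u z ∂μ)
      (((μ.restrict (ball x r)) univ)⁻¹ • μ.restrict (ball x r)) :=
    ((hu x r).aestronglyMeasurable.sub aestronglyMeasurable_const).smul_measure _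
  have hnorm := integral_norm_eq_lintegral_enorm hm
  simp only [Real.norm_eq_abs] at hnorm
  rw [average, hnorm]
  push_cast
  exact ENNReal.toReal_le_of_le_ofReal (by positivity) hosc

theorem IsPoincareSpace.exists_lipschitzOnWith (hPI : IsPoincareSpace μ p)
    (hball : BallsFinitePos μ) (hC : IsDoublingWith μ C) (hp : 0 < p) :
    ∃ L : ℝ≥0, ∀ (u : P → ℝ) (g : P → ℝ≥0∞) (b : ℝ≥0) (S : Set P), IntegrableOnBalls u μ →
      IsUpperGradient (fun y => (u y : EReal)) g → (∀ x ∈ S, IsLebesguePoint μ u x) →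
      (∀ x ∈ S, ∀ r > 0, ∫⁻ y in ball x r, g y ^ p ∂μ ≤ b ^ p * μ (ball x r)) →
      LipschitzOnWith (L * b) u S := by
  obtain ⟨c, hc⟩ := hPI.exists_hasLinearOscillationAt hball hp
  refine ⟨(6 * C + 2 * C ^ 2) * c, fun u g b S hu hg hleb hmax =>
    LipschitzOnWith.of_dist_le_mul fun x hx y hy => ?_⟩
  have hosc : ∀ z ∈ S, HasLinearOscillationAt μ u (c * b) z := fun z hz =>
    hc u g z b hu hg (hmax z hz)
  refine ((hleb x hx).abs_sub_le (hleb y hy) hball hC hu (hosc x hx) (hosc y hy)).trans_eq ?_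
  push_cast
  ring

theorem exists_lipschitzWith_bounded_extension {P : Type*} [PseudoMetricSpace P] {u : P → ℝ}
    {S : Set P} {K k : ℝ≥0} (hlip : LipschitzOnWith K u S) (hk : ∀ x ∈ S, |u x| ≤ k) :
    ∃ v : P → ℝ, LipschitzWith K v ∧ (∀ x, |v x| ≤ k) ∧ EqOn u v S := by
  obtain ⟨v, hv, heq⟩ := hlip.extend_real
  refine ⟨fun x => max (-k) (min k (v x)), (hv.const_min _).const_max _, fun x => abs_le.2
    ⟨le_max_left _ _, max_le (by linarith [k.coe_nonneg]) (min_le_left _ _)⟩, fun x hx => ?_⟩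
  obtain ⟨hlow, hup⟩ := abs_le.1 (hk x hx)
  simp only [← heq hx, min_eq_right hup, max_eq_right hlow]

theorem newtonianNorm_sub_le_of_eqOn_compl [OpensMeasurableSpace P] {u v : P → ℝ} {K k : ℝ≥0}
    {g : P → ℝ≥0∞} {A : Set P} (hum : AEMeasurable u μ) (hu : ∀ x, |u x| ≤ k)
    (hg : IsUpperGradient (fun x => (u x : EReal)) g) (hgX : X g < ∞) (hv : ∀ x, |v x| ≤ k)
    (hlip : LipschitzWith K v) (hA : MeasurableSet A) (heq : EqOn u v Aᶜ) :
    newtonianNorm X (fun x => ((u x - v x : ℝ) : EReal)) ≤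
      X (A.indicator g) + (2 * k + K) * X (A.indicator 1) := by
  have hzero : ∀ x ∉ A, u x - v x = 0 := fun x hx => sub_eq_zero.2 (heq hx)
  have hdiff : IsUpperGradient (fun x => ((u x - v x : ℝ) : EReal)) (fun x => g x + K) := by
    refine hg.of_abs_sub_le_add (isUpperGradient_const_of_lipschitzWith hlip) fun x y => ?_
    simp only [ereal_abs_coe_sub_coe, ← ENNReal.ofReal_add (abs_nonneg _) (abs_nonneg _)]
    rw [sub_sub_sub_comm]
    exact ENNReal.ofReal_le_ofReal (abs_sub _ _)
  have hnorm : X (fun x => ((u x - v x : ℝ) : EReal).abs) ≤ (2 * k : ℝ≥0) * X (A.indicator 1) := by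
    simp only [EReal.abs_def]
    refine X.le_coe_mul_indicator_one hA.nullMeasurableSet
      (hum.sub hlip.continuous.measurable.aemeasurable).abs.ennreal_ofReal (fun x _ => ?_)
      fun x hx => by simp [hzero x hx]
    rw [← ENNReal.ofReal_coe_nnreal, NNReal.coe_mul, NNReal.coe_ofNat, two_mul]
    exact ENNReal.ofReal_le_ofReal ((abs_sub _ _).trans (add_le_add (hu x) (hv x)))
  have hconst : Measurable (A.indicator fun _ => (K : ℝ≥0∞)) := measurable_const.indicator hA
  have hgrad : X (A.indicator fun x => g x + K) ≤ X (A.indicator g) + K * X (A.indicator 1) := by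
    rw [indicator_add]
    refine (X.add_le _ _ (hg.1.indicator hA).aemeasurable hconst.aemeasurable).trans ?_
    gcongr
    exact X.le_coe_mul_indicator_one hA.nullMeasurableSet hconst.aemeasurable
      (fun x hx => (indicator_of_mem hx _).le) fun x hx => indicator_of_notMem hx _
  have hle (x : P) : g x + K ≤ ((1 + K : ℝ≥0) : ℝ≥0∞) * (g x + 1) := by
    push_cast
    rw [add_mul, one_mul, mul_add, mul_one]
    exact add_le_add le_self_add le_add_self
  calc newtonianNorm X (fun x => ((u x - v x : ℝ) : EReal))
      ≤ (2 * k : ℝ≥0) * X (A.indicator 1) + (X (A.indicator g) + K * X (A.indicator 1)) :=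
        (newtonianNorm_le_add_indicator hdiff hg.1 hgX hle hA fun x hx => by
          rw [hzero x hx, EReal.coe_zero]).trans (add_le_add hnorm hgrad)
    _ = _ := by push_cast; ring

theorem integrableOnBalls_of_bounded (hball : BallsFinitePos μ) {u : P → ℝ} {k : ℝ}
    (hk : ∀ x, |u x| ≤ k) (hu : AEMeasurable u μ) : IntegrableOnBalls u μ := fun x r => by
  rcases le_or_gt r 0 with hr | hr
  · simp [ball_eq_empty.2 hr]
  · exact Measure.integrableOn_of_bounded (hball x r hr).2.ne hu.aestronglyMeasurable
      (Eventually.of_forall hk)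

theorem IsPoincareSpace.exists_lipschitzWith_eqOn_compl [BorelSpace P] (hPI : IsPoincareSpace μ p)
    (hball : BallsFinitePos μ) (hC : IsDoublingWith μ C) (hp : 1 ≤ p) :
    ∃ L : ℝ≥0, ∀ (u : P → ℝ) (g : P → ℝ≥0∞) (k a : ℝ≥0), AEMeasurable u μ → (∀ x, |u x| ≤ k) →
      IsUpperGradient (fun y => (u y : EReal)) g →
      ∃ (v : P → ℝ) (A : Set P), LipschitzWith (L * a) v ∧ (∀ x, |v x| ≤ k) ∧ MeasurableSet A ∧
        μ A = μ (exceptionalSet μ p g a) ∧ EqOn u v Aᶜ := by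
  obtain ⟨L, hL⟩ := hPI.exists_lipschitzOnWith hball hC (zero_lt_one.trans_le hp)
  refine ⟨2 * L, fun u g k a hum hk hg => ?_⟩
  have hint : IntegrableOnBalls u μ := integrableOnBalls_of_bounded hball hk hum
  have hN : μ {x | ¬ IsLebesguePoint μ u x} = 0 := ae_iff.1 (hint.ae_isLebesguePoint hball hC)
  set A := exceptionalSet μ p g a ∪ toMeasurable μ {x | ¬ IsLebesguePoint μ u x}
  have hleb : ∀ x ∈ Aᶜ, IsLebesguePoint μ u x := fun x hx =>
    by_contra fun hcon => hx (Or.inr (subset_toMeasurable _ _ hcon))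
  have hlip : LipschitzOnWith (2 * L * a) u Aᶜ := by
    rw [mul_comm 2 L, mul_assoc]
    exact hL u g (2 * a) Aᶜ hint hg hleb fun x hx r hr => by
      simpa using lintegral_ball_rpow_le_of_notMem_exceptionalSet hp (fun h => hx (Or.inl h)) hr
  obtain ⟨v, hv, hvk, heq⟩ := exists_lipschitzWith_bounded_extension hlip fun x _ => hk x
  refine ⟨v, A, hv, hvk, measurableSet_exceptionalSet.union (measurableSet_toMeasurable _ _), ?_,
    heq⟩
  exact measure_congr (union_ae_eq_left_of_ae_eq_empty
    (ae_eq_empty.2 ((measure_toMeasurable _).trans hN)))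

theorem RISpace.ControlsLpMean.exists_lipschitzWith_newtonianNorm_sub_lt [BorelSpace P]
    (hX : X.ControlsLpMean p) (hball : BallsFinitePos μ) (hC : IsDoublingWith μ C) (hp : 1 ≤ p)
    (hPI : IsPoincareSpace μ p) (hAC : X.HasACNorm) {u : P → ℝ} {k : ℝ≥0} (hk : ∀ x, |u x| ≤ k)
    (hum : AEMeasurable u μ) (hu : newtonianNorm X (fun x => (u x : EReal)) < ∞)
    {ε : ℝ≥0∞} (hε : 0 < ε) :
    ∃ (v : P → ℝ) (K : ℝ≥0), LipschitzWith K v ∧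
      newtonianNorm X (fun x => ((u x - v x : ℝ) : EReal)) < ε := by
  obtain ⟨g, hg, hgX⟩ := exists_isUpperGradient_of_newtonianNorm_lt_top hu
  obtain ⟨L, hL⟩ := hPI.exists_lipschitzWith_eqOn_compl hball hC hp
  have hε2 : 0 < ε / 2 := ENNReal.half_pos hε.ne'
  obtain ⟨η, hη, hηε⟩ := ENNReal.exists_nnreal_pos_mul_lt
    (ENNReal.coe_ne_top (r := 2 * k + L)) hε2.ne'
  obtain ⟨δ, hδ, hδX⟩ := hAC.exists_indicator_lt hg.1.aemeasurable hgX hε2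
  obtain ⟨a, ha, hμδ, haη⟩ := hX.exists_exceptionalSet_small hball hC (zero_lt_one.trans_le hp) hAC
    hg.1 hgX (ENNReal.coe_pos.2 hη) hδ
  obtain ⟨v, A, hlip, hv, hA, hμA, heq⟩ := hL u g k a hum hk hg
  rw [← hμA] at hμδ
  rw [← X.indicator_one_congr hA.nullMeasurableSet measurableSet_exceptionalSet.nullMeasurableSet
    hμA] at haη
  refine ⟨v, _, hlip, ?_⟩
  calc newtonianNorm X (fun x => ((u x - v x : ℝ) : EReal))
      ≤ X (A.indicator g) + (2 * k + (L * a : ℝ≥0)) * X (A.indicator 1) :=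
        newtonianNorm_sub_le_of_eqOn_compl hum hk hg hgX hv hlip hA heq
    _ ≤ X (A.indicator g) + (2 * k * a + (L * a : ℝ≥0)) * X (A.indicator 1) := by
        gcongr X _ + (?_ + _) * X _
        exact le_mul_of_one_le_right zero_le (ENNReal.one_le_coe_iff.2 ha)
    _ = X (A.indicator g) + a * X (A.indicator 1) * (2 * k + L : ℝ≥0) := by push_cast; ring
    _ ≤ X (A.indicator g) + η * (2 * k + L : ℝ≥0) := by gcongr
    _ < ε / 2 + ε / 2 := ENNReal.add_lt_add (hδX A hA.nullMeasurableSet hμδ) hηε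
    _ = ε := ENNReal.add_halves ε

theorem RISpace.ControlsLpMean.lipschitzDenseInNewtonian [BorelSpace P] (hX : X.ControlsLpMean p)
    (hball : BallsFinitePos μ) (hdoubling : IsDoubling μ) (hp : 1 ≤ p)
    (hPI : IsPoincareSpace μ p) (hAC : X.HasACNorm) : LipschitzDenseInNewtonian X := by
  intro u ⟨hum, hu⟩ ε hε
  have := hball.sigmaFinite
  have hε2 : 0 < ε / 2 := ENNReal.half_pos hε.ne'
  obtain ⟨C, hC⟩ := hdoubling
  obtain ⟨k, hk⟩ := exists_newtonianNorm_sub_truncateEReal_lt hAC hum hu hε2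
  set T : P → ℝ := fun x => truncateEReal k (u x)
  have hTm : AEMeasurable T μ := (measurable_truncateEReal k).comp_aemeasurable hum
  have hT : newtonianNorm X (fun x => (T x : EReal)) < ∞ :=
    (newtonianNorm_le_newtonianNorm hum hTm.coe_real_ereal
      (fun x => ereal_abs_truncateEReal_le k (u x))
      fun x y => ereal_abs_truncateEReal_sub_le k (u x) (u y)).trans_lt hu
  obtain ⟨v, K, hlip, hvε⟩ := hX.exists_lipschitzWith_newtonianNorm_sub_lt hball hC hp hPI hAC
    (fun x => abs_truncateEReal_le k (u x)) hTm hT hε2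
  have hvm : AEMeasurable v μ := hlip.continuous.measurable.aemeasurable
  have hTv : AEMeasurable (fun x => ((T x - v x : ℝ) : EReal)) μ := (hTm.sub hvm).coe_real_ereal
  refine ⟨v, ⟨K, hlip⟩, ⟨hvm.coe_real_ereal, ?_⟩, ?_⟩
  · refine (newtonianNorm_le_add hTm.coe_real_ereal hTv hvm.coe_real_ereal (fun x => ?_)
      fun x y => ?_).trans_lt (ENNReal.add_lt_top.2 ⟨hT, hvε.trans_le le_top⟩)
    · simp only [EReal.abs_def, ← ENNReal.ofReal_add (abs_nonneg _) (abs_nonneg _)]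
      exact ENNReal.ofReal_le_ofReal (by simpa using abs_sub (T x) (T x - v x))
    · simp only [ereal_abs_coe_sub_coe, ← ENNReal.ofReal_add (abs_nonneg _) (abs_nonneg _)]
      refine ENNReal.ofReal_le_ofReal ?_
      calc |v x - v y| = |(T x - T y) - (T x - v x - (T y - v y))| := by ring_nf
        _ ≤ _ := abs_sub _ _
  · have hsplit (x : P) : u x - v x = (u x - T x) + ((T x - v x : ℝ) : EReal) :=
      (sub_truncateEReal_add_coe k (u x) (v x)).symm
    calc newtonianNorm X (fun x => u x - (v x : EReal))
        ≤ newtonianNorm X (fun x => u x - (T x : EReal)) +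
            newtonianNorm X (fun x => ((T x - v x : ℝ) : EReal)) := by
          refine newtonianNorm_le_add (hum.sub hTm.coe_real_ereal) hTv
            (hum.sub hvm.coe_real_ereal) (fun x => ?_) fun x y => ?_
          · rw [hsplit x]
            exact ereal_abs_add_coe_le _ _
          · rw [hsplit x, hsplit y]
            exact ereal_abs_add_coe_sub_add_coe_le _ _ _ _
      _ < ε / 2 + ε / 2 := ENNReal.add_lt_add hk hvε
      _ = ε := ENNReal.add_halves ε

end LipschitzApproximation

/-! ### Decreasing rearrangements -/

section Rearrangement

variable {α : Type*} [MeasurableSpace α] {μ : Measure α} {f : α → ℝ≥0∞}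

theorem lt_rearr_iff {s : ℝ≥0∞} {t : ℝ} :
    s < rearr μ f t ↔ ENNReal.ofReal t < μ {x | s < f x} := by
  refine ⟨fun hs => by_contra fun hle => hs.not_ge (sInf_le (not_lt.1 hle)), fun ht => ?_⟩
  by_contra! hle
  have hs : s < ∞ := lt_top_iff_ne_top.2 fun hs => by simp [hs] at ht
  obtain ⟨r, hr, hsr, hlim⟩ := exists_seq_strictAnti_tendsto' hs
  have hunion : {x | s < f x} = ⋃ n, {x | r n < f x} := by
    ext x
    simp only [mem_ofPred_eq, mem_iUnion]
    exact ⟨fun hx => (hlim.eventually (gt_mem_nhds hx)).exists, fun ⟨n, hn⟩ => (hsr n).1.trans hn⟩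
  have hmono : Monotone fun n => {x | r n < f x} := fun m n hmn x (hx : r m < f x) =>
    (hr.antitone hmn).trans_lt hx
  rw [hunion, hmono.measure_iUnion] at ht
  refine ht.not_ge (iSup_le fun n => ?_)
  obtain ⟨a, ha, han⟩ := sInf_lt_iff.1 (hle.trans_lt (hsr n).1)
  exact (measure_mono fun x hx => han.trans hx).trans ha

theorem antitone_rearr (μ : Measure α) (f : α → ℝ≥0∞) : Antitone (rearr μ f) := fun _ _ hst =>
  sInf_le_sInf fun _ ha => le_trans ha (ENNReal.ofReal_le_ofReal hst)

theorem rearr_indicator_one (E : Set α) (t : ℝ) :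
    rearr μ (E.indicator 1) t = if ENNReal.ofReal t < μ E then 1 else 0 := by
  refine eq_of_forall_lt_iff fun s => ?_
  rw [lt_rearr_iff, setOf_lt_indicator_one]
  by_cases hs : s < 1 <;> by_cases ht : ENNReal.ofReal t < μ E <;> simp [hs, ht]

theorem setOf_lt_rearr_inter_Ioo {s T : ℝ≥0∞} (hT : T ≠ ∞) (hle : μ {x | s < f x} ≤ T) :
    {t | s < rearr μ f t} ∩ Ioo 0 T.toReal = Ioo 0 (μ {x | s < f x}).toReal := by
  ext t
  simp only [mem_inter_iff, mem_ofPred_eq, mem_Ioo, lt_rearr_iff]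
  have hiff (ht : 0 < t) : ENNReal.ofReal t < μ {x | s < f x} ↔ t < (μ {x | s < f x}).toReal :=
    ENNReal.ofReal_lt_iff_lt_toReal ht.le (ne_top_of_le_ne_top hT hle)
  constructor
  · rintro ⟨hlt, ht, -⟩
    exact ⟨ht, (hiff ht).1 hlt⟩
  · rintro ⟨ht, hlt⟩
    exact ⟨(hiff ht).2 hlt, ht, hlt.trans_le (ENNReal.toReal_mono hT hle)⟩

theorem map_restrict_eq_map_rearr {E : Set α} (hE : NullMeasurableSet E μ) (hfin : μ E ≠ ∞)
    (hf : AEMeasurable f μ) (hfE : ∀ x ∉ E, f x = 0) :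
    (μ.restrict E).map f = (volume.restrict (Ioo 0 (μ E).toReal)).map (rearr μ f) := by
  have hr : Measurable (rearr μ f) := (antitone_rearr μ f).measurable
  have : IsFiniteMeasure (μ.restrict E) := ⟨by simpa using hfin.lt_top⟩
  have huniv : (μ.restrict E).map f univ =
      (volume.restrict (Ioo 0 (μ E).toReal)).map (rearr μ f) univ := by
    rw [Measure.map_apply_of_aemeasurable hf.restrict .univ, Measure.map_apply hr .univ]
    simp [hfin]
  have hIoi (s : ℝ≥0∞) : (μ.restrict E).map f (Ioi s) =
      (volume.restrict (Ioo 0 (μ E).toReal)).map (rearr μ f) (Ioi s) := by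
    have hsub : {x | s < f x} ⊆ E := fun x (hx : s < f x) => by
      by_contra hxE
      exact not_lt_zero (hfE x hxE ▸ hx)
    have hle : μ {x | s < f x} ≤ μ E := measure_mono hsub
    rw [Measure.map_apply_of_aemeasurable hf.restrict measurableSet_Ioi,
      Measure.map_apply hr measurableSet_Ioi, Measure.restrict_apply₀' hE,
      Measure.restrict_apply (hr measurableSet_Ioi)]
    change μ ({x | s < f x} ∩ E) = volume ({t | s < rearr μ f t} ∩ _)
    rw [inter_eq_self_of_subset_left hsub, setOf_lt_rearr_inter_Ioo hfin hle, Real.volume_Ioo,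
      sub_zero, ENNReal.ofReal_toReal (ne_top_of_le_ne_top hfin hle)]
  refine Measure.ext_of_Iic _ _ fun s => ?_
  rw [← compl_Ioi, measure_compl measurableSet_Ioi (measure_ne_top _ _),
    measure_compl measurableSet_Ioi (measure_ne_top _ _), huniv, hIoi]

theorem lintegral_rpow_eq_setLIntegral_rearr {p : ℝ} (hp : 0 < p) {E : Set α}
    (hE : NullMeasurableSet E μ) (hfin : μ E ≠ ∞) (hf : AEMeasurable f μ)
    (hfE : ∀ x ∉ E, f x = 0) :
    ∫⁻ x, f x ^ p ∂μ = ∫⁻ t in Ioo 0 (μ E).toReal, rearr μ f t ^ p := by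
  have hsupport : (Function.support fun x => f x ^ p) ⊆ E := fun x hx => by
    by_contra hxE
    exact hx (by simp only [hfE x hxE, ENNReal.zero_rpow_of_pos hp])
  have hpow : Measurable fun y : ℝ≥0∞ => y ^ p := by fun_prop
  rw [← setLIntegral_eq_of_support_subset hsupport,
    ← lintegral_map' hpow.aemeasurable hf.restrict, map_restrict_eq_map_rearr hE hfin hf hfE,
    lintegral_map hpow (antitone_rearr μ f).measurable]

end Rearrangement

/-! ### The fundamental function -/

/-- A measure is divisible if every null-measurable set has null-measurable subsets of all smaller
measures, as is the case for non-atomic σ-finite Borel measures. The fundamental function of an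
r.i. space is then attained at every `t`. -/
def IsDivisible {α : Type*} [MeasurableSpace α] (μ : Measure α) : Prop :=
  ∀ ⦃G : Set α⦄, NullMeasurableSet G μ → ∀ s ≤ μ G, ∃ F ⊆ G, NullMeasurableSet F μ ∧ μ F = s

namespace RISpace

variable {α : Type*} [MeasurableSpace α] {μ : Measure α} (X : RISpace μ)

theorem fundamental_eq {E : Set α} (hE : NullMeasurableSet E μ) {t : ℝ}
    (ht : μ E = min (ENNReal.ofReal t) (μ univ)) : X.fundamental t = X (E.indicator 1) := by
  unfold fundamental
  split_ifs with hlt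
  · rw [min_eq_left hlt.le] at ht
    refine le_antisymm (iSup_le fun F => iSup_le fun hF => iSup_le fun hFt => ?_) ?_
    · exact (X.indicator_one_congr hF hE (hFt.trans ht.symm)).le
    · exact le_iSup_of_le E (le_iSup_of_le hE (le_iSup_of_le ht le_rfl))
  · rw [min_eq_right (not_lt.1 hlt)] at ht
    rw [X.indicator_one_congr hE nullMeasurableSet_univ ht, indicator_univ]

theorem fundamental_toReal_measure {E : Set α} (hE : NullMeasurableSet E μ) (hfin : μ E ≠ ∞) :
    X.fundamental (μ E).toReal = X (E.indicator 1) :=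
  X.fundamental_eq hE (by
    rw [ENNReal.ofReal_toReal hfin, min_eq_left (measure_mono (subset_univ E))])

theorem exists_fundamental_eq (hμ : IsDivisible μ) (t : ℝ) : ∃ E, NullMeasurableSet E μ ∧
    μ E = min (ENNReal.ofReal t) (μ univ) ∧ X.fundamental t = X (E.indicator 1) := by
  obtain ⟨E, -, hE, hEt⟩ := hμ nullMeasurableSet_univ (min (ENNReal.ofReal t) (μ univ))
    (min_le_right _ _)
  exact ⟨E, hE, hEt, X.fundamental_eq hE hEt⟩

theorem fundamental_lt_top (hμ : IsDivisible μ) (t : ℝ) : X.fundamental t < ∞ := by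
  obtain ⟨E, hE, hEt, hφ⟩ := X.exists_fundamental_eq hμ t
  rw [hφ]
  exact X.indicator_lt_top E hE (hEt ▸ (min_le_left _ _).trans_lt ENNReal.ofReal_lt_top)

theorem fundamental_pos [NeZero μ] (hμ : IsDivisible μ) {t : ℝ} (ht : 0 < t) :
    0 < X.fundamental t := by
  obtain ⟨E, hE, hEt, hφ⟩ := X.exists_fundamental_eq hμ t
  rw [hφ]
  refine X.indicator_one_pos hE ?_
  rw [hEt]
  exact (lt_min (ENNReal.ofReal_pos.2 ht) (Measure.measure_univ_pos.2 (NeZero.ne μ))).ne'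

theorem indicator_one_mono (hμ : IsDivisible μ) {E F : Set α} (hE : NullMeasurableSet E μ)
    (hF : NullMeasurableSet F μ) (hEF : μ E ≤ μ F) : X (E.indicator 1) ≤ X (F.indicator 1) := by
  obtain ⟨G, hGF, hG, hGE⟩ := hμ hF _ hEF
  rw [X.indicator_one_congr hE hG hGE.symm]
  exact X.mono _ _ (aemeasurable_one.indicator₀ hG) (aemeasurable_one.indicator₀ hF)
    (Eventually.of_forall (indicator_le_indicator_of_subset hGF fun _ => zero_le))

theorem monotone_fundamental (hμ : IsDivisible μ) : Monotone X.fundamental := by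
  intro s t hst
  obtain ⟨E, hE, hEs, hφs⟩ := X.exists_fundamental_eq hμ s
  obtain ⟨F, hF, hFt, hφt⟩ := X.exists_fundamental_eq hμ t
  rw [hφs, hφt]
  refine X.indicator_one_mono hμ hE hF ?_
  rw [hEs, hFt]
  exact min_le_min (ENNReal.ofReal_le_ofReal hst) le_rfl

theorem measurable_fundamental_rpow (hμ : IsDivisible μ) (r : ℝ) :
    Measurable fun t => X.fundamental t ^ r :=
  (X.monotone_fundamental hμ).measurable.pow_const r

theorem rearr_mul_fundamental_le (hμ : IsDivisible μ) {f : α → ℝ≥0∞} (hf : AEMeasurable f μ)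
    (t : ℝ) : rearr μ f t * X.fundamental t ≤ X f := by
  obtain ⟨E, hE, hEt, hφ⟩ := X.exists_fundamental_eq hμ t
  rcases eq_or_ne (X.fundamental t) 0 with hzero | hne
  · simp [hzero]
  rw [← ENNReal.le_div_iff_mul_le (Or.inl hne) (Or.inl (X.fundamental_lt_top hμ t).ne)]
  refine ENNReal.le_of_forall_nnreal_lt fun r hr => ?_
  have hsuper : NullMeasurableSet {x | (r : ℝ≥0∞) < f x} μ := hf.nullMeasurable measurableSet_Ioi
  rw [ENNReal.le_div_iff_mul_le (Or.inl hne) (Or.inl (X.fundamental_lt_top hμ t).ne), hφ]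
  calc r * X (E.indicator 1) ≤ r * X ({x | (r : ℝ≥0∞) < f x}.indicator 1) := by
        gcongr
        refine X.indicator_one_mono hμ hE hsuper ?_
        rw [hEt]
        exact (min_le_left _ _).trans (lt_rearr_iff.1 hr).le
    _ ≤ X f := X.coe_mul_indicator_one_le hsuper hf fun x hx => le_of_lt hx

end RISpace

/-! ### The representation space -/

theorem ennreal_eq_of_forall_ofReal_lt_iff {a b : ℝ≥0∞}
    (h : ∀ t : ℝ, 0 < t → (ENNReal.ofReal t < a ↔ ENNReal.ofReal t < b)) : a = b := by
  have hle {a b : ℝ≥0∞} (h : ∀ t : ℝ, 0 < t → ENNReal.ofReal t < a → ENNReal.ofReal t < b) :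
      a ≤ b := by
    refine ENNReal.le_of_forall_nnreal_lt fun r hr => ?_
    rcases eq_zero_or_pos r with rfl | hpos
    · simp
    · simpa using (h r hpos (by simpa using hr)).le
  exact le_antisymm (hle fun t ht => (h t ht).1) (hle fun t ht => (h t ht).2)

theorem measurableEmbedding_coe_RPos : MeasurableEmbedding (Subtype.val : RPos → ℝ) :=
  MeasurableEmbedding.subtype_coe (s := {t : ℝ | 0 < t}) measurableSet_Ioi

theorem setLIntegral_volRPos_setOf_lt (f : ℝ → ℝ≥0∞) (t : ℝ) :
    ∫⁻ x in {x : RPos | (x : ℝ) < t}, f x ∂volRPos = ∫⁻ s in Ioo 0 t, f s := by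
  have hcoe := measurableEmbedding_coe_RPos
  change ∫⁻ x in Subtype.val ⁻¹' Iio t, f x ∂volRPos = _
  rw [volRPos, ← hcoe.lintegral_map f, ← hcoe.restrict_map, hcoe.map_comap,
    Measure.restrict_restrict measurableSet_Iio, Subtype.range_coe_subtype, inter_comm]
  rfl

theorem volRPos_setOf_lt (t : ℝ) : volRPos {x : RPos | (x : ℝ) < t} = ENNReal.ofReal t := by
  rw [← setLIntegral_one, setLIntegral_volRPos_setOf_lt (fun _ => 1), setLIntegral_one,
    Real.volume_Ioo, sub_zero]

theorem dilation_inv_indicator_setOf_lt (s : RPos) (t : ℝ) :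
    dilation s⁻¹ ({x : RPos | (x : ℝ) < t}.indicator 1) =
      {x : RPos | (x : ℝ) < s * t}.indicator 1 := by
  ext x
  have hiff : ((s⁻¹ * x : RPos) : ℝ) < t ↔ (x : ℝ) < s * t := inv_mul_lt_iff₀ s.2
  simp only [dilation, indicator_apply, mem_ofPred_eq, hiff, Pi.one_apply]

namespace RISpace

variable {α : Type*} [MeasurableSpace α] {μ : Measure α} (X : RISpace μ)

theorem reprNorm_eq {f : RPos → ℝ≥0∞} {u : α → ℝ≥0∞} (hu : AEMeasurable u μ)
    (huf : ∀ t : RPos, rearr μ u t =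
      if ENNReal.ofReal t < μ univ then rearr volRPos f t else 0) : X.reprNorm f = X u := by
  refine le_antisymm (iInf_le_of_le u (iInf_le_of_le hu (iInf_le _ huf)))
    (le_iInf fun v => le_iInf fun hv => le_iInf fun hvf => ?_)
  refine (X.rearrangement_invariant u v hu hv fun s => ?_).le
  refine ennreal_eq_of_forall_ofReal_lt_iff fun t ht => ?_
  rw [← lt_rearr_iff, ← lt_rearr_iff, huf ⟨t, ht⟩, hvf ⟨t, ht⟩]

theorem reprNorm_indicator_setOf_lt (hμ : IsDivisible μ) (t : ℝ) :
    X.reprNorm ({x : RPos | (x : ℝ) < t}.indicator 1) = X.fundamental t := by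
  obtain ⟨E, hE, hEt, hφ⟩ := X.exists_fundamental_eq hμ t
  rw [hφ]
  refine X.reprNorm_eq (aemeasurable_one.indicator₀ hE) fun s => ?_
  rw [rearr_indicator_one, rearr_indicator_one, volRPos_setOf_lt, hEt]
  simp only [lt_min_iff, ite_and]
  split_ifs <;> rfl

theorem fundamental_mul_div_fundamental_le_dilationNorm [NeZero μ] (hμ : IsDivisible μ)
    (s : RPos) {t : ℝ} (ht : 0 < t) :
    X.fundamental (s * t) / X.fundamental t ≤ X.dilationNorm s := by
  have hmeas : MeasurableSet {x : RPos | (x : ℝ) < t} := measurable_subtype_coe measurableSet_Iio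
  rw [← X.reprNorm_indicator_setOf_lt hμ (s * t), ← dilation_inv_indicator_setOf_lt,
    ← X.reprNorm_indicator_setOf_lt hμ t]
  refine le_iSup_of_le ({x : RPos | (x : ℝ) < t}.indicator 1) (le_iSup_of_le
    (measurable_one.indicator hmeas).aemeasurable (le_iSup_of_le ?_ (le_iSup_of_le ?_ le_rfl)))
  · rw [X.reprNorm_indicator_setOf_lt hμ]
    exact (X.fundamental_pos hμ ht).ne'
  · rw [X.reprNorm_indicator_setOf_lt hμ]
    exact X.fundamental_lt_top hμ t

theorem upperFundamentalIndex_le_upperBoydIndex [NeZero μ] (hμ : IsDivisible μ) :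
    X.upperFundamentalIndex ≤ X.upperBoydIndex := by
  refine le_iInf₂ fun s hs => iInf₂_le_of_le (s : ℝ) hs ?_
  refine EReal.div_le_div_right_of_nonneg (by exact_mod_cast (Real.log_pos hs).le) ?_
  exact ENNReal.log_monotone
    (iSup₂_le fun t ht => X.fundamental_mul_div_fundamental_le_dilationNorm hμ s ht)

end RISpace

/-! ### Sufficient conditions for the control of `L^p` means -/

theorem mul_rpow_one_div_le_of_rpow_mul_le {q : ℝ} (hq : 0 < q) {a b c d : ℝ≥0∞}
    (h : a ^ q * b ≤ c * d ^ q) : a * b ^ (1 / q) ≤ c ^ (1 / q) * d := by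
  have hroot := ENNReal.rpow_le_rpow h (one_div_nonneg.2 hq.le)
  rwa [ENNReal.mul_rpow_of_nonneg _ _ (by positivity),
    ENNReal.mul_rpow_of_nonneg _ _ (by positivity), ← ENNReal.rpow_mul, ← ENNReal.rpow_mul,
    mul_one_div_cancel hq.ne', ENNReal.rpow_one, ENNReal.rpow_one] at hroot

theorem setLIntegral_Ioo_ofReal_rpow {r : ℝ} (hr : -1 < r) {t : ℝ} (ht : 0 ≤ t) :
    ∫⁻ s in Ioo 0 t, ENNReal.ofReal s ^ r = ENNReal.ofReal (t ^ (r + 1) / (r + 1)) := by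
  have hint : IntegrableOn (fun s : ℝ => s ^ r) (Ioo 0 t) :=
    (intervalIntegrable_iff_integrableOn_Ioo_of_le ht).1
      (intervalIntegral.intervalIntegrable_rpow' hr)
  have hval : ∫ s in Ioo 0 t, s ^ r = t ^ (r + 1) / (r + 1) := by
    rw [← integral_Ioc_eq_integral_Ioo, ← intervalIntegral.integral_of_le ht,
      integral_rpow (Or.inl hr), Real.zero_rpow (by linarith), sub_zero]
  rw [← hval, ofReal_integral_eq_lintegral_ofReal hint
    ((ae_restrict_mem measurableSet_Ioo).mono fun s hs => Real.rpow_nonneg hs.1.le r)]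
  exact setLIntegral_congr_fun measurableSet_Ioo fun s hs => ENNReal.ofReal_rpow_of_pos hs.1

theorem setLAverage_Ioo_eq_setLIntegral_comp_mul_right {f : ℝ → ℝ≥0∞} (hf : Measurable f) {t : ℝ}
    (ht : 0 < t) : ⨍⁻ s in Ioo 0 t, f s ∂volume = ∫⁻ s in Ioo 0 1, f (s * t) := by
  have hmap := Real.smul_map_volume_mul_right ht.ne'
  rw [abs_of_pos ht] at hmap
  have hscale : ∫⁻ s in Ioo 0 t, f s = ENNReal.ofReal t * ∫⁻ s in Ioo 0 1, f (s * t) := by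
    conv_lhs => rw [← hmap]
    rw [Measure.restrict_smul, lintegral_smul_measure, smul_eq_mul,
      setLIntegral_map measurableSet_Ioo hf (by fun_prop), preimage_mul_const_Ioo₀ _ _ ht,
      zero_div, div_self ht.ne']
  rw [setLAverage_eq, hscale, Real.volume_Ioo, sub_zero, mul_comm,
    ENNReal.mul_div_cancel_right (ENNReal.ofReal_pos.2 ht).ne' ENNReal.ofReal_ne_top]

section Embeddings

variable {α : Type*} [MeasurableSpace α] {μ : Measure α} {X : RISpace μ} {p : ℝ}

/- If the constants were unbounded on small sets, choose sets of summable measure on which they blow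
up: their union has finite measure and admits no constant. -/
theorem EmbedsFm.exists_uniform {A B : (α → ℝ≥0∞) → ℝ≥0∞} (hAB : EmbedsFm μ A B) :
    ∃ (c : ℝ≥0) (δ : ℝ≥0∞), 0 < δ ∧ ∀ (E : Set α) (f : α → ℝ≥0∞), NullMeasurableSet E μ →
      μ E < δ → AEMeasurable f μ → (∀ x ∉ E, f x = 0) → A f < ∞ → B f ≤ c * A f := by
  by_contra! hcon
  have hpos : ∀ n : ℕ, (0 : ℝ≥0∞) < 2⁻¹ ^ n := fun n => ENNReal.pow_pos (by simp) n
  choose E f hE hμE hf hfE hA hB using fun n : ℕ => hcon n (2⁻¹ ^ n) (hpos n)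
  have hfin : μ (⋃ n, E n) < ∞ :=
    calc μ (⋃ n, E n) ≤ ∑' n, μ (E n) := measure_iUnion_le _
      _ ≤ ∑' n : ℕ, 2⁻¹ ^ n := ENNReal.tsum_le_tsum fun n => (hμE n).le
      _ = 2 := by rw [ENNReal.tsum_geometric, ENNReal.one_sub_inv_two, inv_inv]
      _ < ∞ := by simp
  obtain ⟨c, hc⟩ := hAB _ (NullMeasurableSet.iUnion hE) hfin
  obtain ⟨n, hn⟩ := exists_nat_ge c
  have hindicator : (⋃ n, E n).indicator (f n) = f n :=
    indicator_eq_self.2 fun x hx => mem_iUnion.2 ⟨n, by_contra fun hxE => hx (hfE n x hxE)⟩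
  have hle := hc (f n) (hf n) (hA n)
  rw [hindicator] at hle
  refine (hB n).not_ge (hle.trans ?_)
  gcongr

theorem ball_coe_RPos (t : RPos) : ball t (t : ℝ) = {x : RPos | (x : ℝ) < 2 * t} := by
  ext x
  have hx : 0 < (x : ℝ) := x.2
  rw [mem_ball, Subtype.dist_eq, Real.dist_eq, abs_lt, mem_ofPred_eq]
  constructor
  · rintro ⟨-, hlt⟩
    linarith
  · intro hlt
    constructor <;> linarith

theorem setLIntegral_Ioo_rpow_le_maximalOp (hp : 0 < p) (f : ℝ → ℝ≥0∞) (t : RPos) :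
    (∫⁻ s in Ioo 0 (t : ℝ), f s ^ p) ^ (1 / p) ≤
      ENNReal.ofReal (2 * t) ^ (1 / p) * maximalOp volRPos p (fun s => f s) t := by
  have ht : 0 < (t : ℝ) := t.2
  have hmax : (⨍⁻ y in ball t (t : ℝ), f y ^ p ∂volRPos) ^ (1 / p) ≤
      maximalOp volRPos p (fun s => f s) t :=
    le_iSup_of_le t (le_iSup_of_le (t : ℝ) (le_iSup_of_le (mem_ball_self ht) le_rfl))
  rw [setLAverage_eq, ball_coe_RPos, volRPos_setOf_lt,
    setLIntegral_volRPos_setOf_lt fun s => f s ^ p] at hmax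
  calc (∫⁻ s in Ioo 0 (t : ℝ), f s ^ p) ^ (1 / p)
      ≤ (∫⁻ s in Ioo 0 (2 * t : ℝ), f s ^ p) ^ (1 / p) := by
        gcongr
        linarith
    _ = ENNReal.ofReal (2 * t) ^ (1 / p) *
          ((∫⁻ s in Ioo 0 (2 * t : ℝ), f s ^ p) / ENNReal.ofReal (2 * t)) ^ (1 / p) := by
        rw [← ENNReal.mul_rpow_of_nonneg _ _ (by positivity),
          ENNReal.mul_div_cancel (ENNReal.ofReal_pos.2 (by positivity)).ne' ENNReal.ofReal_ne_top]
    _ ≤ _ := by gcongr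

theorem lorentzNorm_one_indicator_one (hp : 0 < p) {E : Set α} (hfin : μ E ≠ ∞) :
    lorentzNorm μ p 1 (E.indicator 1) = μ E ^ (1 / p) := by
  have hp' : 0 < 1 / p := by positivity
  have hintegrand : (Ioi 0).indicator (fun t : ℝ =>
        (rearr μ (E.indicator 1) t * ENNReal.ofReal t ^ (1 / p)) ^ (1 : ℝ) / ENNReal.ofReal t) =
      (Ioo 0 (μ E).toReal).indicator fun t => ENNReal.ofReal t ^ (1 / p - 1) := by
    ext t
    by_cases ht : 0 < t
    · simp only [indicator_apply, mem_Ioi, mem_Ioo, ht, true_and, if_true, rearr_indicator_one,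
        ENNReal.ofReal_lt_iff_lt_toReal ht.le hfin, ENNReal.rpow_one, ite_mul, one_mul, zero_mul,
        ENNReal.rpow_sub _ _ (ENNReal.ofReal_pos.2 ht).ne' ENNReal.ofReal_ne_top]
      split_ifs <;> simp
    · simp [ht]
  rw [lorentzNorm, div_one, ENNReal.rpow_one, ← lintegral_indicator measurableSet_Ioi, hintegrand,
    lintegral_indicator measurableSet_Ioo,
    setLIntegral_Ioo_ofReal_rpow (by linarith) ENNReal.toReal_nonneg, sub_add_cancel,
    ← ENNReal.ofReal_mul hp'.le, mul_div_cancel₀ _ hp'.ne',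
    ← ENNReal.ofReal_rpow_of_nonneg ENNReal.toReal_nonneg hp'.le, ENNReal.ofReal_toReal hfin]

theorem mul_rpow_le_quasiconcaveMajorant {φ : ℝ → ℝ≥0∞} {s t : ℝ} (hs : 0 < s) (hst : s ≤ t)
    (ht : t ≤ 1) :
    ENNReal.ofReal s ^ (1 / p) * (φ t / ENNReal.ofReal t ^ (1 / p)) ≤
      quasiconcaveMajorant p φ s := by
  rw [quasiconcaveMajorant, if_neg (not_le.2 hs), if_pos (hst.trans ht)]
  gcongr
  exact le_iSup₂_of_le t ⟨hst, ht⟩ le_rfl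

theorem rpow_div_mul_setLIntegral_rearr_le_lambdaNorm_rpow (hp : 0 < p) (φ : ℝ → ℝ≥0∞)
    (f : α → ℝ≥0∞) {t : ℝ} (ht : t ≤ 1) :
    φ t ^ p / ENNReal.ofReal t * ∫⁻ s in Ioo 0 t, rearr μ f s ^ p ≤
      lambdaNorm μ p (quasiconcaveMajorant p φ) f ^ p := by
  rw [lambdaNorm, ← ENNReal.rpow_mul, one_div_mul_cancel hp.ne', ENNReal.rpow_one,
    ← lintegral_const_mul _ ((antitone_rearr μ f).measurable.pow_const p)]
  refine le_trans (setLIntegral_mono' measurableSet_Ioo fun s hs => ?_)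
    (lintegral_mono_set (Ioo_subset_Ioi_self : Ioo 0 t ⊆ Ioi 0))
  have hs0 : ENNReal.ofReal s ≠ 0 := (ENNReal.ofReal_pos.2 hs.1).ne'
  calc φ t ^ p / ENNReal.ofReal t * rearr μ f s ^ p
      = (rearr μ f s * (ENNReal.ofReal s ^ (1 / p) * (φ t / ENNReal.ofReal t ^ (1 / p)))) ^ p /
          ENNReal.ofReal s := by
        rw [ENNReal.mul_rpow_of_nonneg _ _ hp.le, ENNReal.mul_rpow_of_nonneg _ _ hp.le,
          ENNReal.div_rpow_of_nonneg _ _ hp.le, ← ENNReal.rpow_mul, ← ENNReal.rpow_mul,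
          one_div_mul_cancel hp.ne', ENNReal.rpow_one, ENNReal.rpow_one, mul_div_assoc,
          mul_comm (ENNReal.ofReal s), ENNReal.mul_div_cancel_right hs0 ENNReal.ofReal_ne_top,
          mul_comm]
    _ ≤ _ := by
        gcongr
        exact mul_rpow_le_quasiconcaveMajorant hs.1 hs.2.le ht

namespace RISpace

theorem controlsLpMean_of_eq_zero (hμ : μ = 0) (X : RISpace μ) (p : ℝ) : X.ControlsLpMean p :=
  ⟨0, 1, one_pos, fun E _ _ hE => absurd hE (by simp [hμ])⟩

theorem controlsLpMean_of_embeds_marcinkiewicz (hp : 0 < p)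
    (hX : Embeds μ X (marcinkiewiczLocNorm μ p X.fundamental)) : X.ControlsLpMean p := by
  obtain ⟨c, hc⟩ := hX
  refine ⟨2 ^ (1 / p) * c, 1, one_pos, fun E f hE hpos hlt hf hfE hfX => ?_⟩
  have hfin : μ E ≠ ∞ := (hlt.trans ENNReal.one_lt_top).ne
  set t : RPos := ⟨(μ E).toReal, ENNReal.toReal_pos hpos.ne' hfin⟩
  have ht : (t : ℝ) < 1 := ENNReal.toReal_lt_of_lt_ofReal (by simpa using hlt)
  have hmarc : maximalOp volRPos p (fun s => rearr μ f s) t * X.fundamental t ≤ c * X f := by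
    refine le_trans ?_ (hc f hf hfX)
    exact le_iSup_of_le t (le_iSup_of_le ht le_rfl)
  rw [X.fundamental_toReal_measure hE hfin] at hmarc
  have hscale : ENNReal.ofReal (2 * t) ^ (1 / p) = 2 ^ (1 / p) * μ E ^ (1 / p) := by
    rw [ENNReal.ofReal_mul zero_le_two, ENNReal.mul_rpow_of_nonneg _ _ (by positivity),
      ENNReal.ofReal_toReal hfin, ENNReal.ofReal_ofNat]
  have htwo : ((2 ^ (1 / p) : ℝ≥0) : ℝ≥0∞) = 2 ^ (1 / p) :=
    ENNReal.coe_rpow_of_nonneg _ (by positivity)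
  rw [lintegral_rpow_eq_setLIntegral_rearr hp hE hfin hf hfE]
  calc X (E.indicator 1) * (∫⁻ s in Ioo 0 (t : ℝ), rearr μ f s ^ p) ^ (1 / p)
      ≤ X (E.indicator 1) * (ENNReal.ofReal (2 * t) ^ (1 / p) *
          maximalOp volRPos p (fun s => rearr μ f s) t) := by
        gcongr
        exact setLIntegral_Ioo_rpow_le_maximalOp hp _ t
    _ = 2 ^ (1 / p) * μ E ^ (1 / p) *
          (maximalOp volRPos p (fun s => rearr μ f s) t * X (E.indicator 1)) := by
        rw [hscale]
        ring
    _ ≤ 2 ^ (1 / p) * μ E ^ (1 / p) * (c * X f) := by gcongr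
    _ = ((2 ^ (1 / p) * c : ℝ≥0) : ℝ≥0∞) * μ E ^ (1 / p) * X f := by
        rw [ENNReal.coe_mul, htwo]
        ring

theorem controlsLpMean_of_embedsFm_lambda (hp : 0 < p)
    (hX : EmbedsFm μ X (lambdaNorm μ p (quasiconcaveMajorant p X.fundamental))) :
    X.ControlsLpMean p := by
  obtain ⟨c, δ, hδ, hc⟩ := hX.exists_uniform
  refine ⟨c, min δ 1, lt_min hδ one_pos, fun E f hE hpos hlt hf hfE hfX => ?_⟩
  obtain ⟨hltδ, hlt⟩ := lt_min_iff.1 hlt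
  have hfin : μ E ≠ ∞ := (hlt.trans ENNReal.one_lt_top).ne
  have ht : (μ E).toReal ≤ 1 := (ENNReal.toReal_lt_of_lt_ofReal (by simpa using hlt)).le
  have hlambda := (rpow_div_mul_setLIntegral_rearr_le_lambdaNorm_rpow (μ := μ) hp X.fundamental f
    ht).trans (ENNReal.rpow_le_rpow (hc E f hE hltδ hf hfE hfX) hp.le)
  rw [X.fundamental_toReal_measure hE hfin, ENNReal.ofReal_toReal hfin,
    ← lintegral_rpow_eq_setLIntegral_rearr hp hE hfin hf hfE, ENNReal.mul_comm_div, ← mul_div_assoc,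
    ENNReal.div_le_iff hpos.ne' hfin, mul_comm _ (μ E)] at hlambda
  calc X (E.indicator 1) * (∫⁻ x, f x ^ p ∂μ) ^ (1 / p)
      ≤ μ E ^ (1 / p) * (c * X f) := mul_rpow_one_div_le_of_rpow_mul_le hp hlambda
    _ = c * μ E ^ (1 / p) * X f := by ring

theorem controlsLpMean_of_embedsFm_lorentz (hp : 0 < p) (hLX : EmbedsFm μ (lorentzNorm μ p 1) X)
    (hXL : EmbedsFm μ X (fun f => eLpNorm f (ENNReal.ofReal p) μ)) : X.ControlsLpMean p := by
  obtain ⟨c₁, δ₁, hδ₁, hc₁⟩ := hLX.exists_uniform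
  obtain ⟨c₂, δ₂, hδ₂, hc₂⟩ := hXL.exists_uniform
  refine ⟨c₁ * c₂, min (min δ₁ δ₂) 1, lt_min (lt_min hδ₁ hδ₂) one_pos,
    fun E f hE _ hlt hf hfE hfX => ?_⟩
  simp only [lt_min_iff] at hlt
  obtain ⟨⟨hlt₁, hlt₂⟩, hlt⟩ := hlt
  have hfin : μ E ≠ ∞ := (hlt.trans ENNReal.one_lt_top).ne
  have hindicator : X (E.indicator 1) ≤ c₁ * μ E ^ (1 / p) := by
    rw [← lorentzNorm_one_indicator_one hp hfin]
    refine hc₁ E _ hE hlt₁ (aemeasurable_one.indicator₀ hE)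
      (fun x hx => indicator_of_notMem hx _) ?_
    rw [lorentzNorm_one_indicator_one hp hfin]
    exact ENNReal.rpow_lt_top_of_nonneg (by positivity) hfin
  have hLp : (∫⁻ x, f x ^ p ∂μ) ^ (1 / p) ≤ c₂ * X f := by
    simpa only [eLpNorm_eq_lintegral_rpow_enorm_toReal (ENNReal.ofReal_pos.2 hp).ne'
      ENNReal.ofReal_ne_top, ENNReal.toReal_ofReal hp.le, enorm_eq_self] using
      hc₂ E f hE hlt₂ hf hfE hfX
  calc X (E.indicator 1) * (∫⁻ x, f x ^ p ∂μ) ^ (1 / p)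
      ≤ (c₁ * μ E ^ (1 / p)) * (c₂ * X f) := mul_le_mul' hindicator hLp
    _ = ((c₁ * c₂ : ℝ≥0) : ℝ≥0∞) * μ E ^ (1 / p) * X f := by
        push_cast
        ring

end RISpace

end Embeddings

section FundamentalAverage

namespace RISpace

variable {α : Type*} [MeasurableSpace α] {μ : Measure α} {X : RISpace μ} {p : ℝ}

/-- The averages of `φ^{-p}` over `(0, t)` are controlled by `φ(t)^{-p}` for small `t`, where `φ` is
the fundamental function. This is condition (4) of the theorem, to which (5)–(9) are reduced. -/
def FundamentalAverageBound (X : RISpace μ) (p : ℝ) : Prop :=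
  ∃ δ : ℝ, 0 < δ ∧ ∃ C : ℝ≥0, ∀ t ∈ Ioo 0 δ,
    X.fundamental t ^ p * (⨍⁻ s in Ioo 0 t, X.fundamental s ^ (-p) ∂volume) ≤ C

theorem lintegral_rpow_le_mul_setLIntegral_fundamental [NeZero μ] (hμ : IsDivisible μ)
    (hp : 0 < p) {E : Set α} (hE : NullMeasurableSet E μ) (hfin : μ E ≠ ∞) {f : α → ℝ≥0∞}
    (hf : AEMeasurable f μ) (hfE : ∀ x ∉ E, f x = 0) :
    ∫⁻ x, f x ^ p ∂μ ≤ X f ^ p * ∫⁻ s in Ioo 0 (μ E).toReal, X.fundamental s ^ (-p) := by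
  rw [lintegral_rpow_eq_setLIntegral_rearr hp hE hfin hf hfE,
    ← lintegral_const_mul _ (X.measurable_fundamental_rpow hμ (-p))]
  refine setLIntegral_mono' measurableSet_Ioo fun s hs => ?_
  rw [ENNReal.rpow_neg, ← div_eq_mul_inv, ← ENNReal.div_rpow_of_nonneg _ _ hp.le]
  refine ENNReal.rpow_le_rpow ?_ hp.le
  rw [ENNReal.le_div_iff_mul_le (Or.inl (X.fundamental_pos hμ hs.1).ne')
    (Or.inl (X.fundamental_lt_top hμ s).ne)]
  exact X.rearr_mul_fundamental_le hμ hf s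

theorem FundamentalAverageBound.controlsLpMean [NeZero μ] (hμ : IsDivisible μ) (hp : 0 < p)
    (hX : X.FundamentalAverageBound p) : X.ControlsLpMean p := by
  obtain ⟨δ, hδ, C, hC⟩ := hX
  refine ⟨C ^ (1 / p), ENNReal.ofReal δ, ENNReal.ofReal_pos.2 hδ,
    fun E f hE hpos hlt hf hfE _ => ?_⟩
  have hfin : μ E ≠ ∞ := ne_top_of_lt hlt
  set t : ℝ := (μ E).toReal
  have hmean := hC t ⟨ENNReal.toReal_pos hpos.ne' hfin, ENNReal.toReal_lt_of_lt_ofReal hlt⟩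
  rw [setLAverage_eq, Real.volume_Ioo, sub_zero, ENNReal.ofReal_toReal hfin,
    X.fundamental_toReal_measure hE hfin, ← mul_div_assoc,
    ENNReal.div_le_iff hpos.ne' hfin] at hmean
  have hpow : X (E.indicator 1) ^ p * ∫⁻ x, f x ^ p ∂μ ≤ C * μ E * X f ^ p :=
    calc X (E.indicator 1) ^ p * ∫⁻ x, f x ^ p ∂μ
        ≤ X (E.indicator 1) ^ p * (X f ^ p * ∫⁻ s in Ioo 0 t, X.fundamental s ^ (-p)) := by
          gcongr
          exact lintegral_rpow_le_mul_setLIntegral_fundamental hμ hp hE hfin hf hfE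
      _ = X (E.indicator 1) ^ p * (∫⁻ s in Ioo 0 t, X.fundamental s ^ (-p)) * X f ^ p := by ring
      _ ≤ C * μ E * X f ^ p := by gcongr
  rw [ENNReal.coe_rpow_of_nonneg _ (by positivity),
    ← ENNReal.mul_rpow_of_nonneg _ _ (by positivity)]
  exact mul_rpow_one_div_le_of_rpow_mul_le hp hpow

theorem fundamental_rpow_mul_setLAverage_eq (hμ : IsDivisible μ) (hp : 0 ≤ p) {t : ℝ}
    (ht : 0 < t) :
    X.fundamental t ^ p * (⨍⁻ s in Ioo 0 t, X.fundamental s ^ (-p) ∂volume) =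
      ∫⁻ s in Ioo 0 1, (X.fundamental t / X.fundamental (s * t)) ^ p := by
  rw [setLAverage_Ioo_eq_setLIntegral_comp_mul_right (X.measurable_fundamental_rpow hμ (-p)) ht,
    ← lintegral_const_mul' _ _
      (ENNReal.rpow_ne_top_of_nonneg hp (X.fundamental_lt_top hμ t).ne)]
  refine lintegral_congr fun s => ?_
  rw [ENNReal.rpow_neg, ← div_eq_mul_inv, ← ENNReal.div_rpow_of_nonneg _ _ hp]

theorem fundamentalAverageBound_of_lintegral_lt_top (hμ : IsDivisible μ) (hp : 0 ≤ p)
    (hfin : ∫⁻ s in Ioo (0 : ℝ) 1,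
      (⨆ t ∈ Ioo (0 : ℝ) 1, X.fundamental t / X.fundamental (s * t)) ^ p < ∞) :
    X.FundamentalAverageBound p := by
  refine ⟨1, one_pos, _, fun t ht => le_trans ?_ (ENNReal.coe_toNNReal hfin.ne).ge⟩
  rw [fundamental_rpow_mul_setLAverage_eq hμ hp ht.1]
  gcongr with s
  exact le_iSup₂_of_le t ht le_rfl

theorem fundamentalAverageBound_of_mul_rpow_le [NeZero μ] (hμ : IsDivisible μ) (hp : 0 < p)
    {a δ : ℝ} (ha : a < 1 / p) (hδ : 0 < δ) (K : ℝ≥0)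
    (hφ : ∀ s ∈ Ioo (0 : ℝ) 1, ∀ t ∈ Ioo 0 δ,
      X.fundamental t * ENNReal.ofReal s ^ a ≤ K * X.fundamental (s * t)) :
    X.FundamentalAverageBound p := by
  have hap : -1 < -a * p := by
    rw [lt_div_iff₀ hp] at ha
    linarith
  refine ⟨δ, hδ, K ^ p * (1 / (-a * p + 1)).toNNReal, fun t ht => ?_⟩
  have hratio (s : ℝ) (hs : s ∈ Ioo (0 : ℝ) 1) :
      X.fundamental t / X.fundamental (s * t) ≤ K * ENNReal.ofReal s ^ (-a) := by
    have hs0 : ENNReal.ofReal s ≠ 0 := (ENNReal.ofReal_pos.2 hs.1).ne'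
    rw [ENNReal.rpow_neg, ← div_eq_mul_inv,
      ENNReal.div_le_iff (X.fundamental_pos hμ (mul_pos hs.1 ht.1)).ne'
        (X.fundamental_lt_top hμ _).ne, ← ENNReal.mul_div_right_comm,
      ENNReal.le_div_iff_mul_le
        (Or.inl (ENNReal.rpow_pos (pos_iff_ne_zero.2 hs0) ENNReal.ofReal_ne_top).ne')
        (Or.inl (ENNReal.rpow_ne_top_of_ne_zero hs0 ENNReal.ofReal_ne_top))]
    exact hφ s hs t ht
  rw [fundamental_rpow_mul_setLAverage_eq hμ hp.le ht.1]
  calc ∫⁻ s in Ioo 0 1, (X.fundamental t / X.fundamental (s * t)) ^ p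
      ≤ ∫⁻ s in Ioo (0 : ℝ) 1, (K : ℝ≥0∞) ^ p * ENNReal.ofReal s ^ (-a * p) := by
        refine setLIntegral_mono' measurableSet_Ioo fun s hs => ?_
        rw [ENNReal.rpow_mul, ← ENNReal.mul_rpow_of_nonneg _ _ hp.le]
        exact ENNReal.rpow_le_rpow (hratio s hs) hp.le
    _ = (K : ℝ≥0∞) ^ p * ENNReal.ofReal (1 / (-a * p + 1)) := by
        rw [lintegral_const_mul _ (by fun_prop), setLIntegral_Ioo_ofReal_rpow hap zero_le_one,
          Real.one_rpow]
    _ = ((K ^ p * (1 / (-a * p + 1)).toNNReal : ℝ≥0) : ℝ≥0∞) := by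
        rw [ENNReal.coe_mul, ENNReal.coe_rpow_of_nonneg _ hp.le, ENNReal.ofReal]

theorem fundamentalAverageBound_of_rpow_mul_le [NeZero μ] (hμ : IsDivisible μ) (hp : 0 < p)
    {q δ : ℝ} (hpq : p < q) (hδ : 0 < δ)
    (hφ : ∀ s ∈ Ioo (0 : ℝ) 1, ∀ t ∈ Ioo 0 δ,
      X.fundamental t ^ q * ENNReal.ofReal s ≤ X.fundamental (s * t) ^ q) :
    X.FundamentalAverageBound p :=
  fundamentalAverageBound_of_mul_rpow_le hμ hp (one_div_lt_one_div_of_lt hp hpq) hδ 1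
    fun s hs t ht => by
      simpa only [ENNReal.coe_one, ENNReal.one_rpow] using
        mul_rpow_one_div_le_of_rpow_mul_le (c := 1) (hp.trans hpq)
          ((hφ s hs t ht).trans_eq (one_mul _).symm)

theorem fundamentalAverageBound_of_concaveOn [NeZero μ] (hμ : IsDivisible μ) (hp : 0 < p)
    {q δ : ℝ} (hpq : p < q) (hδ : 0 < δ)
    (hφ : ConcaveOn ℝ (Ico 0 δ) (fun t => (X.fundamental t).toReal ^ q)) :
    X.FundamentalAverageBound p := by
  have hq : 0 ≤ q := (hp.trans hpq).le
  refine fundamentalAverageBound_of_rpow_mul_le hμ hp hpq hδ fun s hs t ht => ?_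
  have hconcave := hφ.2 ⟨ht.1.le, ht.2⟩ ⟨le_rfl, hδ⟩ hs.1.le (sub_nonneg.2 hs.2.le)
    (add_sub_cancel s 1)
  simp only [smul_eq_mul, mul_zero, add_zero] at hconcave
  have hreal : (X.fundamental t).toReal ^ q * s ≤ (X.fundamental (s * t)).toReal ^ q := by
    rw [mul_comm]
    exact (le_add_of_nonneg_right (mul_nonneg (sub_nonneg.2 hs.2.le) (by positivity))).trans
      hconcave
  simpa only [ENNReal.ofReal_mul (Real.rpow_nonneg ENNReal.toReal_nonneg q),
    ← ENNReal.ofReal_rpow_of_nonneg ENNReal.toReal_nonneg hq,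
    ENNReal.ofReal_toReal (X.fundamental_lt_top hμ _).ne] using ENNReal.ofReal_le_ofReal hreal

theorem fundamentalAverageBound_of_antitoneOn [NeZero μ] (hμ : IsDivisible μ) (hp : 0 < p)
    {q δ : ℝ} (hpq : p < q) (hδ : 0 < δ)
    (hφ : AntitoneOn (fun t => X.fundamental t ^ q / ENNReal.ofReal t) (Ioo 0 δ)) :
    X.FundamentalAverageBound p := by
  refine fundamentalAverageBound_of_rpow_mul_le hμ hp hpq hδ fun s hs t ht => ?_
  have hst : 0 < s * t := mul_pos hs.1 ht.1
  have hlt : s * t < t := mul_lt_of_lt_one_left ht.1 hs.2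
  have hle : X.fundamental t ^ q / ENNReal.ofReal t ≤
      X.fundamental (s * t) ^ q / ENNReal.ofReal (s * t) := hφ ⟨hst, hlt.trans ht.2⟩ ht hlt.le
  rwa [ENNReal.le_div_iff_mul_le (Or.inl (ENNReal.ofReal_pos.2 hst).ne')
    (Or.inl ENNReal.ofReal_ne_top), ENNReal.mul_comm_div, ← ENNReal.ofReal_div_of_pos ht.1,
    mul_div_cancel_right₀ s ht.1.ne'] at hle

end RISpace

theorem le_pow_mul_of_forall_le_mul {φ : ℝ → ℝ≥0∞} {σ : ℝ} (hσ : 0 < σ) {K : ℝ≥0∞}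
    (hφ : ∀ t, 0 < t → φ (σ * t) ≤ K * φ t) (n : ℕ) {t : ℝ} (ht : 0 < t) :
    φ (σ ^ n * t) ≤ K ^ n * φ t := by
  induction n with
  | zero => simp
  | succ n ih =>
    calc φ (σ ^ (n + 1) * t) = φ (σ * (σ ^ n * t)) := by ring_nf
      _ ≤ K * (K ^ n * φ t) := (hφ _ (by positivity)).trans (mul_le_mul_right ih _)
      _ = K ^ (n + 1) * φ t := by ring

/- Choosing `n` with `σⁿ ≤ 1 / s < σⁿ⁺¹`, the `n + 1` steps from `st` to `t` cost
`σ^{a(n+1)} ≤ σᵃ s⁻ᵃ`. -/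
theorem mul_rpow_le_of_forall_le_rpow_mul {φ : ℝ → ℝ≥0∞} (hmono : Monotone φ) {σ a : ℝ}
    (hσ : 1 < σ) (ha : 0 ≤ a) (hφ : ∀ t, 0 < t → φ (σ * t) ≤ ENNReal.ofReal (σ ^ a) * φ t)
    {s t : ℝ} (hs : s ∈ Ioo (0 : ℝ) 1) (ht : 0 < t) :
    φ t * ENNReal.ofReal s ^ a ≤ ENNReal.ofReal (σ ^ a) * φ (s * t) := by
  have hσ0 : 0 < σ := zero_lt_one.trans hσ
  obtain ⟨n, hn, hn'⟩ := exists_nat_pow_near (one_le_inv_iff₀.2 ⟨hs.1, hs.2.le⟩) hσ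
  have hφt : φ t ≤ ENNReal.ofReal ((σ ^ a) ^ (n + 1)) * φ (s * t) := by
    rw [ENNReal.ofReal_pow (by positivity)]
    refine (hmono ?_).trans (le_pow_mul_of_forall_le_mul hσ0 hφ (n + 1) (mul_pos hs.1 ht))
    rw [← mul_assoc]
    exact le_mul_of_one_le_left ht.le ((inv_le_iff_one_le_mul₀ hs.1).1 hn'.le)
  have hpow : (σ ^ a) ^ n * s ^ a ≤ 1 := by
    rw [← Real.rpow_mul_natCast hσ0.le, mul_comm a, Real.rpow_natCast_mul hσ0.le,
      ← Real.mul_rpow (by positivity) hs.1.le]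
    exact Real.rpow_le_one (mul_nonneg (by positivity) hs.1.le)
      ((le_inv_mul_iff₀' hs.1).1 (by simpa using hn)) ha
  have hcost : (σ ^ a) ^ (n + 1) * s ^ a ≤ σ ^ a := by
    rw [pow_succ', mul_assoc]
    exact mul_le_of_le_one_right (by positivity) hpow
  calc φ t * ENNReal.ofReal s ^ a
      ≤ ENNReal.ofReal ((σ ^ a) ^ (n + 1)) * φ (s * t) * ENNReal.ofReal s ^ a := by gcongr
    _ = ENNReal.ofReal ((σ ^ a) ^ (n + 1) * s ^ a) * φ (s * t) := by
        rw [ENNReal.ofReal_mul (by positivity), ← ENNReal.ofReal_rpow_of_nonneg hs.1.le ha]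
        ring
    _ ≤ ENNReal.ofReal (σ ^ a) * φ (s * t) := by gcongr

namespace RISpace

variable {α : Type*} [MeasurableSpace α] {μ : Measure α} {X : RISpace μ} {p : ℝ}

theorem exists_fundamental_mul_le_of_upperFundamentalIndex_lt [NeZero μ] (hμ : IsDivisible μ)
    {b : ℝ} (hb : 0 < b) (hX : X.upperFundamentalIndex < (b : EReal)) :
    ∃ σ a : ℝ, 1 < σ ∧ 0 ≤ a ∧ a < b ∧
      ∀ t, 0 < t → X.fundamental (σ * t) ≤ ENNReal.ofReal (σ ^ a) * X.fundamental t := by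
  simp only [upperFundamentalIndex, iInf_lt_iff] at hX
  obtain ⟨σ, hσ, hlt⟩ := hX
  have hlog : 0 < Real.log σ := Real.log_pos hσ
  rw [EReal.div_lt_iff (by exact_mod_cast hlog) (EReal.coe_ne_top _), ← EReal.coe_mul] at hlt
  obtain ⟨m, hm, hmb⟩ := EReal.lt_iff_exists_real_btwn.1 hlt
  have hpow : σ ^ (max m 0 / Real.log σ) = Real.exp (max m 0) := by
    rw [Real.rpow_def_of_pos (zero_lt_one.trans hσ), mul_div_cancel₀ _ hlog.ne']
  have hsup : (⨆ (t : ℝ) (_ : 0 < t), X.fundamental (σ * t) / X.fundamental t) ≤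
      ENNReal.ofReal (σ ^ (max m 0 / Real.log σ)) := by
    rw [← ENNReal.log_le_log_iff, hpow, ENNReal.log_ofReal_of_pos (Real.exp_pos _), Real.log_exp]
    exact hm.le.trans (EReal.coe_le_coe_iff.2 (le_max_left _ _))
  refine ⟨σ, max m 0 / Real.log σ, hσ, by positivity, ?_, fun t ht => ?_⟩
  · rw [div_lt_iff₀ hlog]
    exact max_lt (EReal.coe_lt_coe_iff.1 hmb) (by positivity)
  · rw [← ENNReal.div_le_iff (X.fundamental_pos hμ ht).ne' (X.fundamental_lt_top hμ t).ne]
    exact le_trans (le_iSup₂_of_le t ht le_rfl) hsup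

theorem fundamentalAverageBound_of_upperFundamentalIndex_lt [NeZero μ] (hμ : IsDivisible μ)
    (hp : 0 < p) (hX : X.upperFundamentalIndex < ((1 / p : ℝ) : EReal)) :
    X.FundamentalAverageBound p := by
  obtain ⟨σ, a, hσ, ha, hap, hφ⟩ :=
    exists_fundamental_mul_le_of_upperFundamentalIndex_lt hμ (one_div_pos.2 hp) hX
  exact fundamentalAverageBound_of_mul_rpow_le hμ hp hap one_pos (σ ^ a).toNNReal
    fun s hs t ht =>
      mul_rpow_le_of_forall_le_rpow_mul (X.monotone_fundamental hμ) hσ ha hφ hs ht.1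

end RISpace

end FundamentalAverage

end

theorem mainTheorem3 {P : Type*} [MetricSpace P] [MeasurableSpace P] [BorelSpace P]
    (μ : Measure P) (hball : BallsFinitePos μ) (hdoubling : IsDoubling μ) [NullSingletonClass μ]
    (p : ℝ) (hp : 1 ≤ p) (hPI : IsPoincareSpace μ p)
    (X : RISpace μ) (hAC : X.HasACNorm)
    (h :
      Embeds μ X (marcinkiewiczLocNorm μ p X.fundamental) ∨
      EmbedsFm μ X (lambdaNorm μ p (quasiconcaveMajorant p X.fundamental)) ∨
      (EmbedsFm μ (lorentzNorm μ p 1) X ∧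
        EmbedsFm μ X (fun f => eLpNorm f (ENNReal.ofReal p) μ)) ∨
      (∃ δ : ℝ, 0 < δ ∧ ∃ C : ℝ≥0, ∀ t ∈ Ioo 0 δ,
        X.fundamental t ^ p * (⨍⁻ s in Ioo 0 t, X.fundamental s ^ (-p) ∂volume) ≤ C) ∨
      (∃ q δ : ℝ, p < q ∧ 0 < δ ∧
        ConcaveOn ℝ (Ico 0 δ) (fun t => (X.fundamental t).toReal ^ q)) ∨
      (∃ q δ : ℝ, p < q ∧ 0 < δ ∧
        AntitoneOn (fun t => X.fundamental t ^ q / ENNReal.ofReal t) (Ioo 0 δ)) ∨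
      (∫⁻ s in Ioo (0 : ℝ) 1,
        (⨆ t ∈ Ioo (0 : ℝ) 1, X.fundamental t / X.fundamental (s * t)) ^ p) < ∞ ∨
      X.upperFundamentalIndex < ((1 / p : ℝ) : EReal) ∨
      X.upperBoydIndex < ((1 / p : ℝ) : EReal)) :
    LipschitzDenseInNewtonian X := by
  have := hball.secondCountableTopology
  have := hball.sigmaFinite
  have hμ : IsDivisible μ := fun _ hG _ hs => exists_subset_measure_eq hG hs
  have hp0 : 0 < p := by linarith
  suffices hX : X.ControlsLpMean p from hX.lipschitzDenseInNewtonian hball hdoubling hp hPI hAC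
  rcases eq_zero_or_neZero μ with hzero | _
  · exact RISpace.controlsLpMean_of_eq_zero hzero X p
  rcases h with h | h | ⟨hL, hLp⟩ | h
  · exact RISpace.controlsLpMean_of_embeds_marcinkiewicz hp0 h
  · exact RISpace.controlsLpMean_of_embedsFm_lambda hp0 h
  · exact RISpace.controlsLpMean_of_embedsFm_lorentz hp0 hL hLp
  refine RISpace.FundamentalAverageBound.controlsLpMean hμ hp0 ?_
  rcases h with h | ⟨q, δ, hpq, hδ, h⟩ | ⟨q, δ, hpq, hδ, h⟩ | h | h | h
  · exact h
  · exact RISpace.fundamentalAverageBound_of_concaveOn hμ hp0 hpq hδ h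
  · exact RISpace.fundamentalAverageBound_of_antitoneOn hμ hp0 hpq hδ h
  · exact RISpace.fundamentalAverageBound_of_lintegral_lt_top hμ hp0.le h
  · exact RISpace.fundamentalAverageBound_of_upperFundamentalIndex_lt hμ hp0 h
  · exact RISpace.fundamentalAverageBound_of_upperFundamentalIndex_lt hμ hp0
      ((X.upperFundamentalIndex_le_upperBoydIndex hμ).trans_lt h)
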